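/- Fix a prime $p$. A crystalline prism is a $p$-torsion free, $p$-adically complete $\delta$-ring (with the ideal $(p)$); its Frobenius lift is $\varphi(x)=x^p+p\,\delta(x)$. For a ring $S$ with a Frobenius lift $\varphi$ and an ideal $I\ni p$, a prismatic envelope of $(S,\varphi,I)$ is a crystalline prism $E$ with a ring map $S\to E$ that commutes with the Frobenius lifts and sends $I$ into $pE$, and that is universal among such maps to crystalline prisms. Let $A$ be a crystalline prism, $R$ a $p$-adically complete $A$-algebra, and $\square: A\langle X_1^{\pm1},\dots,X_d^{\pm1}\rangle\to R$ a $p$-completely étale homomorphism of $A$-algebras (étale modulo every power of $p$; in particular $R$ is $p$-completely smooth over $A$). Let $\delta_1,\delta_2$ be $\delta$-structures on $R$ compatible with that of $A$ and such that $\delta_1(x)-\delta_2(x)\in pR$ for all $x\in R$. Let $\varphi_1,\varphi_2$ be the corresponding Frobenius lifts. Give the $p$-completed tensor product $R\hat\otimes_A R$ the Frobenius lift $\varphi_1\hat\otimes\varphi_2$, and let $J=\ker(R\hat\otimes_A R\to R)$ be the kernel of the diagonal. Let $\mathfrak a\subset R$ be an ideal containing $p$. For a ring $S$, let $S[Y_1,\dots,Y_d]_{\mathrm{pd}}^\wedge$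 be the $p$-adic completion of the divided power polynomial ring over $S$. (1) The prismatic envelope $R_{1,2}$ of $(R\hat\otimes_A R,(p,J))$ exists, and there is an isomorphism of rings $\iota_\square: R_{1,2}\cong R[Y_1,\dots,Y_d]_{\mathrm{pd}}^\wedge$ under which $R\xrightarrow{\mathrm{id}\otimes 1}R_{1,2}$ becomes the scalar embedding and $R\xrightarrow{1\otimes\mathrm{id}}R_{1,2}$ becomes an embedding with $X_i\mapsto X_i+pY_i$ for all $i$. (Here $X_i$ also denotes its image in $R$.) (2) The prismatic envelopes $D_i$ of $(R,\varphi_i,\mathfrak a)$ for $i=1,2$ and $D_{1,2}$ of $(R\hat\otimes_A R,(x\otimes 1: x\in\mathfrak a)+J)$ exist. Give $D_1$ and $D_2$ the induced maps $R/\mathfrak a\to D_i/p$, and $D_{1,2}$ the map $R/\mathfrak a\to D_{1,2}/p$ induced by $x\mapsto x\otimes1$. Then the maps $x\mapsto x\otimes 1$ and $x\mapsto 1\otimes x$ induce morphisms $D_1\to D_{1,2}$ and $D_2\to D_{1,2}$ which make $D_{1,2}$ the coproduct of $D_1$ and $D_2$ in the category of crystalline prisms $C$ over $A$ equipped with a map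 of $A$-algebras $R/\mathfrak a\to C/p$. There is an isomorphism of rings $D_{1,2}\cong D_1[Y_1,\dots,Y_d]_{\mathrm{pd}}^\wedge$ under which $D_1\to D_{1,2}$ becomes the scalar embedding and $1\otimes X_i$ becomes $X_i+pY_i$ for all $i$. -/

import Mathlib

universe u

open CategoryTheory

noncomputable section

namespace Prismatic

/-! ### Reduction modulo powers of `p` and `p`-adic completion -/

section Completion

variable (p : ℕ) {S T : Type*} [CommRing S] [CommRing T]

/-- The principal ideal `(p)`. -/
abbrev pIdeal (S : Type*) [CommRing S] : Ideal S := Ideal.span {(p : S)}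

lemma pIdeal_pow_le_comap (f : S →+* T) (n : ℕ) :
    pIdeal p S ^ n ≤ (pIdeal p T ^ n).comap f := by
  rw [pIdeal, pIdeal, Ideal.span_singleton_pow, Ideal.span_singleton_pow,
    Ideal.span_singleton_le_iff_mem, Ideal.mem_comap, map_pow, map_natCast]
  exact Ideal.mem_span_singleton_self _

lemma pIdeal_le_comap (f : S →+* T) : pIdeal p S ≤ (pIdeal p T).comap f := by
  rw [pIdeal, Ideal.span_singleton_le_iff_mem, Ideal.mem_comap, map_natCast]
  exact Ideal.mem_span_singleton_self _

/-- The map `S / p → T / p` induced by `f : S → T`. -/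
def redMod (f : S →+* T) : S ⧸ pIdeal p S →+* T ⧸ pIdeal p T :=
  Ideal.quotientMap _ f (pIdeal_le_comap p f)

/-- The map `S / p ^ n → T / p ^ n` induced by `f : S → T`. -/
def redModPow (f : S →+* T) (n : ℕ) : S ⧸ pIdeal p S ^ n →+* T ⧸ pIdeal p T ^ n :=
  Ideal.quotientMap _ f (pIdeal_pow_le_comap p f n)

/-- The `p`-adic completion `lim S / p ^ n`. -/
abbrev PCompletion (S : Type*) [CommRing S] : Type _ := AdicCompletion (pIdeal p S) S

lemma completionMap_compat (f : S →+* T) {m n : ℕ} (hle : m ≤ n) :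
    (Ideal.Quotient.factorPow (pIdeal p T) hle).comp
      ((redModPow p f n).comp (AdicCompletion.evalₐ (pIdeal p S) n).toRingHom) =
    (redModPow p f m).comp (AdicCompletion.evalₐ (pIdeal p S) m).toRingHom := by
  ext x
  induction x using AdicCompletion.induction_on with
  | h a =>
    simp only [RingHom.comp_apply, AlgHom.toRingHom_eq_coe, RingHom.coe_coe, AdicCompletion.evalₐ_mk, redModPow,
      Ideal.quotientMap_mk]
    rw [Ideal.Quotient.factorPow, Ideal.Quotient.factor_mk, ← sub_eq_zero, ← map_sub,
      Ideal.Quotient.eq_zero_iff_mem, ← map_sub]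
    apply pIdeal_pow_le_comap p f m
    have h := a.2 hle
    rw [SModEq.sub_mem] at h
    rw [← neg_sub]
    exact neg_mem (by simpa using h)

/-- The map on `p`-adic completions induced by `f : S → T`. -/
def completionMap (f : S →+* T) : PCompletion p S →+* PCompletion p T :=
  AdicCompletion.liftRingHom (pIdeal p T)
    (fun n => (redModPow p f n).comp (AdicCompletion.evalₐ (pIdeal p S) n).toRingHom)
    (completionMap_compat p f)

@[simp]
lemma completionMap_algebraMap (f : S →+* T) (x : S) :
    completionMap p f (algebraMap S (PCompletion p S) x)
      = algebraMap T (PCompletion p T) (f x) := by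
  refine AdicCompletion.ext_evalₐ (H := fun n => ?_)
  rw [completionMap, AdicCompletion.evalₐ_liftRingHom _ _ (completionMap_compat p f)]
  simp [redModPow]

/-- The map from the `p`-adic completion of `S` to a `p`-adically complete ring `T` induced by
`f : S → T`. -/
def completionLift [IsAdicComplete (pIdeal p T) T] (f : S →+* T) : PCompletion p S →+* T :=
  ((AdicCompletion.ofAlgEquiv (pIdeal p T)).symm : PCompletion p T →+* T).comp
    (completionMap p f)

@[simp]
lemma completionLift_algebraMap [IsAdicComplete (pIdeal p T) T] (f : S →+* T) (x : S) :
    completionLift p f (algebraMap S (PCompletion p S) x) = f x := by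
  simp only [completionLift, RingHom.comp_apply, completionMap_algebraMap]
  exact AdicCompletion.ofAlgEquiv_symm_of (pIdeal p T) (f x)

/-- A homomorphism `f : S → T` of `p`-adically complete rings is `p`-completely étale if it is
étale modulo every power of `p`. -/
def IsPCompletelyEtale (f : S →+* T) : Prop := ∀ n : ℕ, (redModPow p f n).Etale

end Completion

/-! ### δ-rings and crystalline prisms -/

/-- A `δ`-structure (relative to the prime `p`) on a ring. The coefficient
`p.choose j / p` is the integer `(1 / p) * binom(p, j)` for `0 < j < p`. -/
structure DeltaStructure (p : ℕ) (S : Type*) [CommRing S] where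
  δ : S → S
  map_zero : δ 0 = 0
  map_one : δ 1 = 0
  map_add : ∀ x y, δ (x + y) =
    δ x + δ y - ∑ j ∈ Finset.Ioo 0 p, ((p.choose j / p : ℕ) : S) * x ^ j * y ^ (p - j)
  map_mul : ∀ x y, δ (x * y) = x ^ p * δ y + y ^ p * δ x + (p : S) * δ x * δ y

section Delta

variable {p : ℕ} [hp : Fact p.Prime] {S : Type*} [CommRing S]

lemma add_pow_eq (x y : S) : (x + y) ^ p = x ^ p + y ^ p +
    (p : S) * ∑ j ∈ Finset.Ioo 0 p, ((p.choose j / p : ℕ) : S) * x ^ j * y ^ (p - j) := by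
  have h0 : 0 < p := hp.out.pos
  have hIoo : Finset.range p = insert 0 (Finset.Ioo 0 p) := by
    ext j
    simp only [Finset.mem_range, Finset.mem_insert, Finset.mem_Ioo]
    omega
  rw [add_pow, Finset.sum_range_succ, hIoo, Finset.sum_insert (by simp), Finset.mul_sum]
  have : ∀ j ∈ Finset.Ioo 0 p, x ^ j * y ^ (p - j) * (p.choose j : S) =
      (p : S) * (((p.choose j / p : ℕ) : S) * x ^ j * y ^ (p - j)) := by
    intro j hj
    rw [Finset.mem_Ioo] at hj
    have hd : p ∣ p.choose j := hp.out.dvd_choose_self hj.1.ne' hj.2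
    have hc : (p.choose j : S) = (p : S) * ((p.choose j / p : ℕ) : S) := by
      rw [← Nat.cast_mul, Nat.mul_div_cancel' hd]
    rw [hc]
    ring
  rw [Finset.sum_congr rfl this]
  simp
  ring

/-- The Frobenius lift `φ(x) = x ^ p + p δ(x)` of a `δ`-structure. -/
def DeltaStructure.frob (D : DeltaStructure p S) : S →+* S where
  toFun x := x ^ p + (p : S) * D.δ x
  map_zero' := by simp [D.map_zero, hp.out.ne_zero]
  map_one' := by simp [D.map_one]
  map_add' x y := by
    rw [D.map_add, add_pow_eq]
    ring
  map_mul' x y := by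
    rw [D.map_mul]
    ring

end Delta

/-- A crystalline prism: a `p`-torsion free, `p`-adically complete `δ`-ring
(with the ideal `(p)`). -/
structure CrystallinePrism (p : ℕ) where
  carrier : Type u
  [commRing : CommRing carrier]
  delta : DeltaStructure p carrier
  complete : IsAdicComplete (pIdeal p carrier) carrier
  torsionFree : ∀ x : carrier, (p : carrier) * x = 0 → x = 0

instance (p : ℕ) : CoeSort (CrystallinePrism.{u} p) (Type u) := ⟨CrystallinePrism.carrier⟩

attribute [instance] CrystallinePrism.commRing

/-- A ring homomorphism between crystalline prisms is a morphism of prisms if it commutes with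
the `δ`-structures. -/
def IsDeltaHom {p : ℕ} {B C : CrystallinePrism.{u} p} (g : B →+* C) : Prop :=
  ∀ x, g (B.delta.δ x) = C.delta.δ (g x)

/-- A `δ`-structure on an algebra `R` over a crystalline prism `A` such that `A → R` commutes
with `δ`. -/
structure DeltaStructureOver {p : ℕ} (A : CrystallinePrism.{u} p) (R : Type u) [CommRing R]
    [Algebra A R] extends DeltaStructure p R where
  algebraMap_δ : ∀ a : A, algebraMap A R (A.delta.δ a) = δ (algebraMap A R a)

section

variable {p : ℕ} [Fact p.Prime]

lemma frob_algebraMap {A : CrystallinePrism.{u} p} {R : Type u} [CommRing R] [Algebra A R]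
    (D : DeltaStructureOver A R) (a : A) :
    D.frob (algebraMap A R a) = algebraMap A R (A.delta.frob a) := by
  simp [DeltaStructure.frob, D.algebraMap_δ]

/-- Into a `p`-torsion free ring, commuting with Frobenius implies commuting with `δ`. -/
lemma map_δ_of_map_frob {S : Type*} [CommRing S] (D : DeltaStructure p S)
    (C : CrystallinePrism.{u} p) (g : S →+* C) (x : S)
    (h : g (D.frob x) = C.delta.frob (g x)) : g (D.δ x) = C.delta.δ (g x) := by
  have h' : g x ^ p + (p : C) * g (D.δ x) = g x ^ p + (p : C) * C.delta.δ (g x) := by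
    simpa [DeltaStructure.frob] using h
  exact sub_eq_zero.mp (C.torsionFree _ (by linear_combination h'))

/-! ### Prismatic envelopes -/

/-- A prismatic envelope of `(S, φ, I)`, where `φ` is a Frobenius lift on `S` and `I` is an ideal
containing `p`: a crystalline prism with a map `incl` from `S` that commutes with the Frobenius
and sends `I` into `(p)` (that is, induces `S / I → prism / p`), universal among such. -/
structure PrismaticEnvelope (p : ℕ) [Fact p.Prime] (S : Type u) [CommRing S] (φ : S →+* S)
    (I : Ideal S) where
  prism : CrystallinePrism.{u} p
  incl : S →+* prism
  incl_frob : ∀ x, incl (φ x) = prism.delta.frob (incl x)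
  incl_mem : ∀ x ∈ I, incl x ∈ pIdeal p prism
  universal : ∀ (B : CrystallinePrism.{u} p) (f : S →+* B),
    (∀ x, f (φ x) = B.delta.frob (f x)) → (∀ x ∈ I, f x ∈ pIdeal p B) →
    ∃! g : prism →+* B, IsDeltaHom g ∧ g.comp incl = f

/-! ### The category of prisms over `B` relative to `A` -/

/-- An object `(B → C / p ← C)` of the (opposite of the) prismatic site `(B / A)_Δ`: a crystalline
prism `C` over `A` with a map `B → C / p` of `A`-algebras. -/
structure RelPrism (A : CrystallinePrism.{u} p) (B : Type u) [CommRing B] [Algebra A B] where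
  prism : CrystallinePrism.{u} p
  str : A →+* prism
  isDeltaHom_str : IsDeltaHom str
  point : B →+* prism ⧸ pIdeal p prism
  point_algebraMap : ∀ a : A, point (algebraMap A B a) = Ideal.Quotient.mk _ (str a)

namespace RelPrism

variable {A : CrystallinePrism.{u} p} {B : Type u} [CommRing B] [Algebra A B]

/-- Morphisms of prisms over `A` that are compatible with the maps from `B`. -/
@[ext]
structure Hom (C D : RelPrism A B) where
  map : C.prism →+* D.prism
  isDeltaHom : IsDeltaHom map
  map_str : ∀ a : A, map (C.str a) = D.str a
  map_point : ∀ b : B, redMod p map (C.point b) = D.point b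

instance : Category (RelPrism A B) where
  Hom := Hom
  id C := ⟨RingHom.id _, fun _ => rfl, fun _ => rfl, fun b => by
    obtain ⟨c, hc⟩ := Ideal.Quotient.mk_surjective (C.point b)
    rw [← hc]
    simp [redMod]⟩
  comp {C D E} f g := ⟨g.map.comp f.map,
    fun x => by rw [RingHom.comp_apply, f.isDeltaHom, g.isDeltaHom, RingHom.comp_apply],
    fun a => by rw [RingHom.comp_apply, f.map_str, g.map_str],
    fun b => by
      rw [← g.map_point, ← f.map_point]
      obtain ⟨c, hc⟩ := Ideal.Quotient.mk_surjective (C.point b)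
      rw [← hc]
      simp [redMod]⟩

/-- For an `A`-algebra `R` with an ideal `𝔞` and a map `f : R → C` to a crystalline prism that
sends `𝔞` into `(p)` and whose restriction to `A` commutes with `δ`, the object
`(R / 𝔞 → C / p ← C)`. -/
abbrev ofHom {R : Type u} [CommRing R] [Algebra A R] {𝔞 : Ideal R} (C : CrystallinePrism.{u} p)
    (f : R →+* C) (hf : ∀ a : A, f (algebraMap A R (A.delta.δ a)) = C.delta.δ (f (algebraMap A R a)))
    (h𝔞 : 𝔞 ≤ (pIdeal p C).comap f) : RelPrism A (R ⧸ 𝔞) where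
  prism := C
  str := f.comp (algebraMap A R)
  isDeltaHom_str := hf
  point := Ideal.quotientMap _ f h𝔞
  point_algebraMap a := by
    rw [IsScalarTower.algebraMap_apply A R (R ⧸ 𝔞), Ideal.Quotient.algebraMap_eq,
      Ideal.quotientMap_mk, RingHom.comp_apply]

end RelPrism

/-! ### The ring `R ⊗̂_A R` -/

section CompletedTensor

variable (A : CrystallinePrism.{u} p) (R : Type u) [CommRing R] [Algebra A R]

open scoped TensorProduct

/-- The `p`-adically completed tensor product `R ⊗̂_A R`. -/
abbrev CompletedTensor : Type u := PCompletion p (R ⊗[A] R)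

/-- The map `id ⊗ 1 : R → R ⊗̂_A R`. -/
def inl : R →+* CompletedTensor A R :=
  (algebraMap (R ⊗[A] R) (CompletedTensor A R)).comp
    Algebra.TensorProduct.includeLeftRingHom

/-- The map `1 ⊗ id : R → R ⊗̂_A R`. -/
def inr : R →+* CompletedTensor A R :=
  (algebraMap (R ⊗[A] R) (CompletedTensor A R)).comp
    (Algebra.TensorProduct.includeRight : R →ₐ[A] R ⊗[A] R).toRingHom

/-- The diagonal `R ⊗̂_A R → R`. -/
def diagonal [IsAdicComplete (pIdeal p R) R] : CompletedTensor A R →+* R :=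
  completionLift p (Algebra.TensorProduct.lmul' A : R ⊗[A] R →ₐ[A] R).toRingHom

/-- The kernel `J` of the diagonal. -/
def diagonalKer [IsAdicComplete (pIdeal p R) R] : Ideal (CompletedTensor A R) :=
  RingHom.ker (diagonal A R)

variable {A R}

/-- The Frobenius lift `φ₁ ⊗̂ φ₂` on `R ⊗̂_A R`. -/
def tensorFrob (D₁ D₂ : DeltaStructureOver A R) : CompletedTensor A R →+* CompletedTensor A R :=
  completionMap p (Algebra.TensorProduct.mapRingHom A.delta.frob D₁.frob D₂.frob
    (by ext a; exact frob_algebraMap D₁ a) (by ext a; exact frob_algebraMap D₂ a))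

lemma tensorFrob_inl (D₁ D₂ : DeltaStructureOver A R) (x : R) :
    tensorFrob D₁ D₂ (inl A R x) = inl A R (D₁.frob x) := by
  simp [tensorFrob, inl]

lemma tensorFrob_inr (D₁ D₂ : DeltaStructureOver A R) (x : R) :
    tensorFrob D₁ D₂ (inr A R x) = inr A R (D₂.frob x) := by
  simp [tensorFrob, inr]

/-- The prismatic envelope of `(R, φ, 𝔞)`, as an object of `((R / 𝔞) / A)_Δ`. -/
abbrev PrismaticEnvelope.toRelPrism {D : DeltaStructureOver A R} {𝔞 : Ideal R}
    (E : PrismaticEnvelope p R D.frob 𝔞) : RelPrism A (R ⧸ 𝔞) :=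
  RelPrism.ofHom E.prism E.incl
    (fun a => by
      rw [D.algebraMap_δ]
      exact map_δ_of_map_frob D.toDeltaStructure E.prism E.incl _ (E.incl_frob _))
    E.incl_mem

/-- The prismatic envelope of `R ⊗̂_A R` with respect to the ideal generated by the elements
`x ⊗ 1` for `x ∈ 𝔞` and by `J`, as an object of `((R / 𝔞) / A)_Δ`; the map
`R / 𝔞 → E / p` is `x ↦ x ⊗ 1`. -/
abbrev PrismaticEnvelope.toRelPrismTensor [IsAdicComplete (pIdeal p R) R]
    {D₁ D₂ : DeltaStructureOver A R} {𝔞 : Ideal R}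
    (E : PrismaticEnvelope p (CompletedTensor A R) (tensorFrob D₁ D₂)
      (𝔞.map (inl A R) ⊔ diagonalKer A R)) : RelPrism A (R ⧸ 𝔞) :=
  RelPrism.ofHom E.prism (E.incl.comp (inl A R))
    (fun a => by
      rw [D₁.algebraMap_δ]
      refine map_δ_of_map_frob D₁.toDeltaStructure E.prism (E.incl.comp (inl A R)) _ ?_
      rw [RingHom.comp_apply, RingHom.comp_apply, ← tensorFrob_inl D₁ D₂, E.incl_frob])
    (fun x hx => E.incl_mem _ (Ideal.mem_sup_left (Ideal.mem_map_of_mem _ hx)))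

end CompletedTensor

/-! ### Toric charts and completed divided power polynomial rings -/

/-- The ring `A⟨X₁^{±1}, …, X_d^{±1}⟩`: the `p`-adic completion of the ring of Laurent
polynomials over `A` in `d` variables. -/
abbrev CompletedTorus (A : CrystallinePrism.{u} p) (d : ℕ) : Type u :=
  PCompletion p (AddMonoidAlgebra A (Fin d → ℤ))

/-- The coordinate `X_i`. -/
def CompletedTorus.X (A : CrystallinePrism.{u} p) {d : ℕ} (i : Fin d) : CompletedTorus A d :=
  algebraMap (AddMonoidAlgebra A (Fin d → ℤ)) _ (AddMonoidAlgebra.single (Pi.single i 1) 1)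

/-- The ring `S[Y₁, …, Y_d]_pd^∧`: the `p`-adic completion of the divided power polynomial ring
over `S` in `d` variables (the divided power algebra of the free module `S ^ d`). -/
abbrev CompletedPDPoly (p : ℕ) (S : Type u) [CommRing S] (d : ℕ) : Type u :=
  PCompletion p (DividedPowerAlgebra S (Fin d → S))

/-- The variable `Y_i`. -/
def CompletedPDPoly.Y (p : ℕ) (S : Type u) [CommRing S] {d : ℕ} (i : Fin d) :
    CompletedPDPoly p S d :=
  algebraMap (DividedPowerAlgebra S (Fin d → S)) _
    (DividedPowerAlgebra.dp S 1 (Pi.single i 1))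

end

end Prismatic

end

/-! An envelope is built by hand: inside `S[1/p]` take the smallest subring that contains `S` and
`p⁻¹I` and is stable under `(φ(y) - y ^ p) / p`, and complete it. Its universal property rests on
the fact that a `p`-torsion free target `B` embeds in `B[1/p]`.

The description by divided powers comes from two opposite constructions. From polynomials to the
envelope: put `y = (1 ⊗ X_i - X_i ⊗ 1) / p`. Since `δ₁ ≡ δ₂` modulo `p`, the elements `1 ⊗ φ₂(x)`
and `φ₁(x) ⊗ 1` agree modulo `p ^ 2` (`sq_dvd_map_frob_sub`), so `φ(y) ∈ (p)`. In a crystalline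
prism this forces `n! ∣ y ^ n` for all `n` (`hasDividedPowers_of_dvd_frob`), and `Y_i ↦ y` is
allowed. From the envelope to polynomials: étaleness lifts `X_i ↦ X_i + p Y_i` to a map `τ` on `R`
(`exists_chart_lift`). The same congruence modulo `p ^ 2` dictates a Frobenius with `Y_i ↦ p z_i`,
which extends to divided powers and lifts the `p`-th power map (`exists_completedPDPoly_frob`). Then
`τ` intertwines `φ₂` with this Frobenius (`chart_lift_frob`), and the universal property applies.
Both composites are identities by uniqueness (`exists_envelope_equiv`).

Part (1) is the case `𝔞 = (p)`, where `R`, being `p`-torsion free by flatness, is its own envelope.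
The coproduct property is formal: a pair of maps out of `D₁` and `D₂` over `R / 𝔞` is a
Frobenius-compatible map on `R ⊗̂_A R` that sends `𝔞` and `J` into `(p)`. -/

noncomputable section

namespace Prismatic

/-! ### Divisibility by powers of `p`, completion and torsion -/

section

variable {p : ℕ} {S T : Type*} [CommRing S] [CommRing T]

lemma mem_pIdeal {x : S} : x ∈ pIdeal p S ↔ (p : S) ∣ x := Ideal.mem_span_singleton

lemma mem_pIdeal_pow {x : S} {n : ℕ} : x ∈ pIdeal p S ^ n ↔ (p : S) ^ n ∣ x := by
  rw [pIdeal, Ideal.span_singleton_pow, Ideal.mem_span_singleton]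

lemma mk_eq_mk_iff {x y : S} :
    Ideal.Quotient.mk (pIdeal p S) x = Ideal.Quotient.mk (pIdeal p S) y ↔ (p : S) ∣ x - y := by
  rw [Ideal.Quotient.eq, mem_pIdeal]

lemma mk_pow_eq_mk_pow_iff {x y : S} {n : ℕ} :
    Ideal.Quotient.mk (pIdeal p S ^ n) x = Ideal.Quotient.mk (pIdeal p S ^ n) y ↔
      (p : S) ^ n ∣ x - y := by
  rw [Ideal.Quotient.eq, mem_pIdeal_pow]

lemma eq_zero_of_forall_pow_dvd [IsHausdorff (pIdeal p T) T] {x : T}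
    (h : ∀ n : ℕ, (p : T) ^ n ∣ x) : x = 0 := by
  refine IsHausdorff.haus ‹IsHausdorff (pIdeal p T) T› x fun n => ?_
  rw [SModEq.zero, smul_eq_mul, Ideal.mul_top, mem_pIdeal_pow]
  exact h n

lemma eq_of_forall_pow_dvd [IsHausdorff (pIdeal p T) T] {x y : T}
    (h : ∀ n : ℕ, (p : T) ^ n ∣ x - y) : x = y :=
  sub_eq_zero.mp (eq_zero_of_forall_pow_dvd h)

instance pCompletion_isAdicComplete :
    IsAdicComplete (pIdeal p (PCompletion p S)) (PCompletion p S) := by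
  have h : pIdeal p (PCompletion p S) =
      (pIdeal p S).map (algebraMap S (PCompletion p S)) := by
    simp only [pIdeal, Ideal.map_span, Set.image_singleton, map_natCast]
  rw [h, IsAdicComplete.map_algebraMap_iff]
  exact AdicCompletion.isAdicComplete ⟨{(p : S)}, by simp [pIdeal]⟩

/-- Because `(p)` is finitely generated, the kernel of the projection of the completion to `S / p ^
n` is generated by `p ^ n`. -/
lemma pow_dvd_iff_evalₐ_eq_zero {n : ℕ} {x : PCompletion p S} :
    (p : PCompletion p S) ^ n ∣ x ↔ AdicCompletion.evalₐ (pIdeal p S) n x = 0 := by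
  constructor
  · rintro ⟨y, rfl⟩
    rw [map_mul, map_pow, map_natCast, ← map_natCast (Ideal.Quotient.mk (pIdeal p S ^ n)),
      ← map_pow, Ideal.Quotient.eq_zero_iff_mem.mpr (mem_pIdeal_pow.mpr dvd_rfl), zero_mul]
  · intro h
    have h1 : x ∈ (AdicCompletion.eval (pIdeal p S) S n).ker := by
      rw [LinearMap.mem_ker, ← AdicCompletion.factor_evalₐ_eq_eval _ x (by simp), h, map_zero]
    rw [← AdicCompletion.pow_smul_top_eq_ker_eval ⟨{(p : S)}, by simp [pIdeal]⟩,
      Ideal.span_singleton_pow, Submodule.ideal_span_singleton_smul,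
      Submodule.mem_smul_pointwise_iff_exists] at h1
    obtain ⟨y, -, rfl⟩ := h1
    exact ⟨y, by rw [Algebra.smul_def, map_pow, map_natCast]⟩

/-- Density of `S` in its completion. It replaces continuity arguments: a statement modulo `p ^ n`
about ring maps need only be tested on `S`. -/
lemma exists_eq_algebraMap_add (n : ℕ) (x : PCompletion p S) :
    ∃ (y : S) (z : PCompletion p S),
      x = algebraMap S (PCompletion p S) y + (p : PCompletion p S) ^ n * z := by
  obtain ⟨y, hy⟩ := Ideal.Quotient.mk_surjective (AdicCompletion.evalₐ (pIdeal p S) n x)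
  obtain ⟨z, hz⟩ := (pow_dvd_iff_evalₐ_eq_zero (n := n)
    (x := x - algebraMap S (PCompletion p S) y)).mpr (by
      rw [map_sub, ← hy, sub_eq_zero]
      exact (AdicCompletion.evalₐ_of _ n y).symm)
  exact ⟨y, z, by rw [← hz]; ring⟩

lemma pow_dvd_algebraMap_iff {n : ℕ} {y : S} :
    (p : PCompletion p S) ^ n ∣ algebraMap S (PCompletion p S) y ↔ (p : S) ^ n ∣ y := by
  rw [pow_dvd_iff_evalₐ_eq_zero, ← mem_pIdeal_pow, ← Ideal.Quotient.eq_zero_iff_mem]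
  exact (AdicCompletion.evalₐ_of _ n y).congr_left

lemma algebraMap_pCompletion {B : Type*} [CommRing B] [Algebra B S] (b : B) :
    algebraMap B (PCompletion p S) b = algebraMap S (PCompletion p S) (algebraMap B S b) := rfl

lemma ringHom_ext_of_isHausdorff [IsHausdorff (pIdeal p T) T] {f g : PCompletion p S →+* T}
    (h : ∀ x, f (algebraMap S _ x) = g (algebraMap S _ x)) : f = g := by
  ext x
  refine eq_of_forall_pow_dvd (p := p) fun n => ?_
  obtain ⟨y, z, rfl⟩ := exists_eq_algebraMap_add n x
  exact ⟨f z - g z, by simp [h]; ring⟩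

lemma dvd_map_sub_map_of_algebraMap {f g : PCompletion p S →+* T}
    (h : ∀ x, (p : T) ∣ f (algebraMap S _ x) - g (algebraMap S _ x)) (x : PCompletion p S) :
    (p : T) ∣ f x - g x := by
  obtain ⟨y, z, rfl⟩ := exists_eq_algebraMap_add 1 x
  obtain ⟨w, hw⟩ := h y
  exact ⟨w + f z - g z, by simp; linear_combination hw⟩

variable (p S) in
/-- Multiplication by `p` on `S` is injective. -/
def TorsionFree : Prop := ∀ x : S, (p : S) * x = 0 → x = 0

lemma TorsionFree.cancel (h : TorsionFree p S) {x y : S} (hxy : (p : S) * x = p * y) : x = y :=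
  sub_eq_zero.mp (h _ (by rw [mul_sub, hxy, sub_self]))

lemma TorsionFree.pow_cancel (h : TorsionFree p S) {n : ℕ} {x y : S}
    (hxy : (p : S) ^ n * x = p ^ n * y) : x = y := by
  induction n with
  | zero => simpa using hxy
  | succ n ih => exact ih (h.cancel (by rw [← mul_assoc, ← mul_assoc, ← pow_succ', hxy]))

lemma TorsionFree.of_injective (h : TorsionFree p T) (f : S →+* T) (hf : Function.Injective f) :
    TorsionFree p S := fun x hx => hf (by
  rw [map_zero]
  exact h _ (by rw [← map_natCast f, ← map_mul, hx, map_zero]))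

/-- If `p x = 0` and `y ∈ S` approximates `x` modulo `p ^ n`, then `p ^ (n + 1)` divides `p y`,
already in `S`; cancelling `p` gives `p ^ n ∣ y`, hence `p ^ n ∣ x`. -/
lemma TorsionFree.pCompletion (h : TorsionFree p S) : TorsionFree p (PCompletion p S) := by
  intro x hx
  refine eq_zero_of_forall_pow_dvd (p := p) fun n => ?_
  obtain ⟨y, z, rfl⟩ := exists_eq_algebraMap_add n x
  refine dvd_add (pow_dvd_algebraMap_iff.mpr ?_) (dvd_mul_right _ _)
  have h1 : (p : PCompletion p S) ^ (n + 1) ∣ algebraMap S _ ((p : S) * y) :=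
    ⟨-z, by rw [map_mul, map_natCast]; linear_combination hx⟩
  obtain ⟨w, hw⟩ := pow_dvd_algebraMap_iff.mp h1
  exact ⟨w, h.cancel (by rw [hw]; ring)⟩

end

/-! ### Units and integer torsion in `p`-adically complete rings -/

section Unit

variable {p : ℕ} {T : Type*} [CommRing T] [IsAdicComplete (pIdeal p T) T]

lemma isUnit_add_of_dvd {u x : T} (hu : IsUnit u) (hx : (p : T) ∣ x) : IsUnit (u + x) := by
  have hx' : x ∈ (⊥ : Ideal T).jacobson :=
    IsAdicComplete.le_jacobson_bot (pIdeal p T) (mem_pIdeal.mpr hx)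
  obtain ⟨v, hv⟩ := hu.exists_right_inv
  have h := Ideal.mem_jacobson_bot.mp hx' v
  have h2 : u + x = u * (x * v + 1) := by linear_combination (-x) * hv
  rw [h2]
  exact hu.mul h

lemma isUnit_natCast_of_coprime {n : ℕ} (hn : n.Coprime p) : IsUnit (n : T) := by
  have h := Nat.gcd_eq_gcd_ab n p
  rw [hn] at h
  have h2 : (1 : T) = n * (n.gcdA p : T) + p * (n.gcdB p : T) := by
    exact_mod_cast congrArg (Int.cast : ℤ → T) h
  refine isUnit_of_mul_isUnit_left (y := (n.gcdA p : T)) ?_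
  rw [show (n : T) * (n.gcdA p : T) = 1 + p * -(n.gcdB p : T) by linear_combination -h2]
  exact isUnit_add_of_dvd isUnit_one (dvd_mul_right _ _)

/-- Multiplication by every nonzero natural number on `T` is injective. -/
def NatTorsionFree (T : Type*) [CommRing T] : Prop :=
  ∀ (n : ℕ) (x : T), n ≠ 0 → (n : T) * x = 0 → x = 0

/-- Write `n = p ^ k * m` with `m` prime to `p`; then `m` is a unit by completeness. -/
lemma TorsionFree.natTorsionFree [hp : Fact p.Prime] (h : TorsionFree p T) : NatTorsionFree T := by
  intro n x hn hx
  obtain ⟨k, m, hm, rfl⟩ := Nat.exists_eq_pow_mul_and_not_dvd hn p hp.out.ne_one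
  have hu : IsUnit (m : T) := isUnit_natCast_of_coprime
    ((Nat.Prime.coprime_iff_not_dvd hp.out).mpr hm).symm
  refine h.pow_cancel (n := k) (hu.mul_left_cancel ?_)
  rw [mul_zero, mul_zero, ← hx]
  push_cast
  ring

end Unit

attribute [instance] CrystallinePrism.complete

/-! ### Frobenius lifts and `δ`-structures on torsion free rings -/

section Frobenius

variable {p : ℕ} [hp : Fact p.Prime] {S : Type*} [CommRing S]

lemma DeltaStructure.frob_apply (D : DeltaStructure p S) (x : S) :
    D.frob x = x ^ p + (p : S) * D.δ x := rfl

lemma DeltaStructure.dvd_frob_sub_pow (D : DeltaStructure p S) (x : S) :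
    (p : S) ∣ D.frob x - x ^ p := ⟨D.δ x, by rw [D.frob_apply]; ring⟩

/-- The `δ`-structure of a lift of the Frobenius on a `p`-torsion free ring. -/
def DeltaStructure.ofFrob (h : TorsionFree p S) (φ : S →+* S)
    (hφ : ∀ x, (p : S) ∣ φ x - x ^ p) : DeltaStructure p S where
  δ x := (hφ x).choose
  map_zero := h _ (by rw [← (hφ 0).choose_spec]; simp [hp.out.ne_zero])
  map_one := h _ (by rw [← (hφ 1).choose_spec]; simp)
  map_add x y := h.cancel (by
    rw [← (hφ (x + y)).choose_spec, mul_sub, mul_add, ← (hφ x).choose_spec,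
      ← (hφ y).choose_spec, _root_.map_add, add_pow_eq]
    ring)
  map_mul x y := h.cancel (by
    have hx := (hφ x).choose_spec
    have hy := (hφ y).choose_spec
    rw [← (hφ (x * y)).choose_spec, _root_.map_mul]
    linear_combination (φ y) * hx + (x ^ p + p * (hφ x).choose) * hy)

lemma DeltaStructure.frob_ofFrob (h : TorsionFree p S) (φ : S →+* S)
    (hφ : ∀ x, (p : S) ∣ φ x - x ^ p) : (DeltaStructure.ofFrob h φ hφ).frob = φ := by
  ext x
  rw [frob_apply, ofFrob, ← (hφ x).choose_spec]
  ring

lemma dvd_add_pow_sub (x y : S) : (p : S) ∣ (x + y) ^ p - (x ^ p + y ^ p) :=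
  
  ⟨_, by rw [add_pow_eq, add_sub_cancel_left]⟩

/-- A lift of the Frobenius on the image of `S` in its completion is a lift of the Frobenius. -/
lemma dvd_map_sub_pow_of_algebraMap {φ : PCompletion p S →+* PCompletion p S}
    (h : ∀ x : S, (p : PCompletion p S) ∣ φ (algebraMap S _ x) - algebraMap S _ x ^ p)
    (x : PCompletion p S) : (p : PCompletion p S) ∣ φ x - x ^ p := by
  obtain ⟨y, z, rfl⟩ := exists_eq_algebraMap_add 1 x
  obtain ⟨w, hw⟩ := h y
  obtain ⟨v, hv⟩ := dvd_add_pow_sub (p := p) (algebraMap S (PCompletion p S) y)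
    ((p : PCompletion p S) ^ 1 * z)
  obtain ⟨u, hu⟩ := dvd_pow (dvd_mul_of_dvd_left (dvd_pow_self (p : PCompletion p S) one_ne_zero) z)
    hp.out.ne_zero
  refine ⟨w + φ z - v - u, ?_⟩
  rw [map_add, map_mul, map_pow, map_natCast]
  linear_combination hw - hv - hu

/-- The crystalline prism given by a `p`-torsion free, `p`-adically complete ring with a lift of
the Frobenius. -/
@[reducible]
def CrystallinePrism.ofFrob (S : Type u) [CommRing S] [hc : IsAdicComplete (pIdeal p S) S]
    (h : TorsionFree p S) (φ : S →+* S) (hφ : ∀ x, (p : S) ∣ φ x - x ^ p) :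
    CrystallinePrism.{u} p where
  carrier := S
  delta := DeltaStructure.ofFrob h φ hφ
  complete := hc
  torsionFree := h

lemma IsDeltaHom.of_map_frob {B C : CrystallinePrism.{u} p} {g : B →+* C}
    (h : ∀ x, g (B.delta.frob x) = C.delta.frob (g x)) : IsDeltaHom g :=
  fun x => map_δ_of_map_frob B.delta C g x (h x)

lemma IsDeltaHom.map_frob {B C : CrystallinePrism.{u} p} {g : B →+* C}
    (h : IsDeltaHom g) (x : B) : g (B.delta.frob x) = C.delta.frob (g x) := by
  rw [DeltaStructure.frob_apply, DeltaStructure.frob_apply, ← h, map_add, map_mul, map_pow,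
    map_natCast]

end Frobenius

/-! ### Existence of prismatic envelopes -/

section Envelope

set_option linter.unusedSectionVars false

variable {p : ℕ} [hp : Fact p.Prime] {S : Type u} [CommRing S]

/-- The extension of an endomorphism to the localization away from `p`. -/
def locMap (φ : S →+* S) : Localization.Away (p : S) →+* Localization.Away (p : S) :=
  IsLocalization.map (M := Submonoid.powers (p : S)) (T := Submonoid.powers (p : S)) _ φ (by
    rw [Submonoid.powers_le, Submonoid.mem_comap, map_natCast]
    exact Submonoid.mem_powers _)

lemma locMap_algebraMap (φ : S →+* S) (x : S) :
    locMap (p := p) φ (algebraMap S _ x) = algebraMap S _ (φ x) :=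
  IsLocalization.map_eq _ _

lemma isUnit_natCast_localization : IsUnit (p : Localization.Away (p : S)) := by
  rw [← map_natCast (algebraMap S (Localization.Away (p : S)))]
  exact IsLocalization.Away.algebraMap_isUnit _

lemma exists_natCast_mul_eq (x : Localization.Away (p : S)) :
    ∃ y : Localization.Away (p : S), (p : Localization.Away (p : S)) * y = x := by
  obtain ⟨v, hv⟩ := (isUnit_natCast_localization (p := p) (S := S)).exists_right_inv
  exact ⟨v * x, by rw [← mul_assoc, hv, one_mul]⟩

/-- A subring of `S[1/p]` is admissible if it contains the images of `S` and of `p⁻¹ I` and is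
closed under `x ↦ (φ x - x ^ p) / p`. -/
structure IsAdmissible (φ : S →+* S) (I : Ideal S) (T : Subring (Localization.Away (p : S))) :
    Prop where
  algebraMap_mem : ∀ x : S, algebraMap S _ x ∈ T
  div_mem : ∀ x ∈ I, ∀ y : Localization.Away (p : S),
    (p : Localization.Away (p : S)) * y = algebraMap S _ x → y ∈ T
  delta_mem : ∀ y ∈ T, ∀ z : Localization.Away (p : S),
    (p : Localization.Away (p : S)) * z = locMap φ y - y ^ p → z ∈ T

variable (φ : S →+* S) (I : Ideal S)

/-- The smallest admissible subring of `S[1/p]`. -/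
def envelopeRing : Subring (Localization.Away (p : S)) :=
  sInf {T | IsAdmissible φ I T}

lemma isAdmissible_envelopeRing : IsAdmissible φ I (envelopeRing (p := p) φ I) where
  algebraMap_mem x := Subring.mem_sInf.mpr fun _ hT => hT.algebraMap_mem x
  div_mem x hx y hy := Subring.mem_sInf.mpr fun _ hT => hT.div_mem x hx y hy
  delta_mem y hy z hz := Subring.mem_sInf.mpr fun T hT =>
    hT.delta_mem y (Subring.mem_sInf.mp hy T hT) z hz

variable {φ I} in
lemma envelopeRing_le {T : Subring (Localization.Away (p : S))} (hT : IsAdmissible φ I T) :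
    envelopeRing φ I ≤ T := sInf_le hT

lemma exists_envelopeRing_delta (y : envelopeRing (p := p) φ I) :
    ∃ z : envelopeRing (p := p) φ I,
      locMap φ y.1 = y.1 ^ p + (p : Localization.Away (p : S)) * z.1 := by
  obtain ⟨z, hz⟩ := exists_natCast_mul_eq (locMap φ y.1 - y.1 ^ p)
  exact ⟨⟨z, (isAdmissible_envelopeRing φ I).delta_mem _ y.2 z hz⟩,
    (sub_eq_iff_eq_add'.mp hz.symm)⟩

/-- The lift of the Frobenius on the smallest admissible subring. -/
def envelopeFrob : envelopeRing (p := p) φ I →+* envelopeRing (p := p) φ I :=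
  (locMap φ).restrict _ _ fun y hy => by
    obtain ⟨z, hz⟩ := exists_envelopeRing_delta φ I ⟨y, hy⟩
    rw [hz]
    exact add_mem (pow_mem hy p) (mul_mem (natCast_mem _ p) z.2)

lemma coe_envelopeFrob (y : envelopeRing (p := p) φ I) :
    (envelopeFrob φ I y : Localization.Away (p : S)) = locMap φ y := rfl

lemma dvd_envelopeFrob_sub (y : envelopeRing (p := p) φ I) :
    (p : envelopeRing (p := p) φ I) ∣ envelopeFrob φ I y - y ^ p := by
  obtain ⟨z, hz⟩ := exists_envelopeRing_delta φ I y
  refine ⟨z, Subtype.ext ?_⟩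
  push_cast
  rw [coe_envelopeFrob, hz]
  ring

lemma torsionFree_envelopeRing : TorsionFree p (envelopeRing (p := p) φ I) :=
  TorsionFree.of_injective (T := Localization.Away (p : S))
    (fun _ hx => isUnit_natCast_localization.mul_left_cancel (hx.trans (mul_zero _).symm))
    (envelopeRing φ I).subtype Subtype.val_injective

/-- The underlying crystalline prism of the prismatic envelope. -/
@[reducible]
def envelopePrism : CrystallinePrism.{u} p :=
  CrystallinePrism.ofFrob (PCompletion p (envelopeRing (p := p) φ I))
    (torsionFree_envelopeRing φ I).pCompletion (completionMap p (envelopeFrob φ I))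
    (dvd_map_sub_pow_of_algebraMap fun x => by
      rw [completionMap_algebraMap, ← map_pow, ← map_sub, ← pow_one (p : PCompletion p _),
        pow_dvd_algebraMap_iff, pow_one]
      exact dvd_envelopeFrob_sub φ I x)

lemma envelopePrism_frob : (envelopePrism (p := p) φ I).delta.frob =
    completionMap p (envelopeFrob φ I) :=
  DeltaStructure.frob_ofFrob (torsionFree_envelopeRing φ I).pCompletion _ _

/-- The map from `S` to the smallest admissible subring. -/
def toEnvelopeRing : S →+* envelopeRing (p := p) φ I :=
  (algebraMap S (Localization.Away (p : S))).codRestrict _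
    (isAdmissible_envelopeRing φ I).algebraMap_mem

lemma coe_toEnvelopeRing (x : S) :
    (toEnvelopeRing (p := p) φ I x : Localization.Away (p : S)) = algebraMap S _ x := rfl

lemma envelopeFrob_toEnvelopeRing (x : S) :
    envelopeFrob (p := p) φ I (toEnvelopeRing φ I x) = toEnvelopeRing φ I (φ x) :=
  Subtype.ext (locMap_algebraMap φ x)

lemma dvd_toEnvelopeRing {x : S} (hx : x ∈ I) :
    (p : envelopeRing (p := p) φ I) ∣ toEnvelopeRing φ I x := by
  obtain ⟨y, hy⟩ := exists_natCast_mul_eq (p := p) (algebraMap S (Localization.Away (p : S)) x)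
  exact ⟨⟨y, (isAdmissible_envelopeRing φ I).div_mem x hx y hy⟩, Subtype.ext hy.symm⟩

/-- Two maps from the smallest admissible subring to a crystalline prism that commute with the
Frobenius and agree on `S` are equal. -/
lemma envelopeRing_hom_ext {B : CrystallinePrism.{u} p}
    {g g' : envelopeRing (p := p) φ I →+* B}
    (hg : ∀ x, g (envelopeFrob φ I x) = B.delta.frob (g x))
    (hg' : ∀ x, g' (envelopeFrob φ I x) = B.delta.frob (g' x))
    (h : ∀ x, g (toEnvelopeRing φ I x) = g' (toEnvelopeRing φ I x)) : g = g' := by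
  have hB : TorsionFree p B := B.torsionFree
  -- The locus where the two maps agree is itself admissible, as `p` can be cancelled in `B`. By
  -- minimality it is everything.
  have hadm : IsAdmissible φ I ((g.eqLocus g').map (envelopeRing (p := p) φ I).subtype) := by
    refine ⟨fun x => ⟨_, h x, rfl⟩, fun x hx y hy => ?_, ?_⟩
    · refine ⟨⟨y, (isAdmissible_envelopeRing φ I).div_mem x hx y hy⟩, hB.cancel ?_, rfl⟩
      rw [← map_natCast g, ← map_mul]
      conv_rhs => rw [map_natCast g, ← map_natCast g', ← map_mul]
      have hy' : (p : envelopeRing (p := p) φ I) *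
          ⟨y, (isAdmissible_envelopeRing φ I).div_mem x hx y hy⟩ = toEnvelopeRing φ I x :=
        Subtype.ext hy
      rw [hy', h]
    · rintro _ ⟨y, hy, rfl⟩ z hz
      have hy' : g y = g' y := hy
      refine ⟨⟨z, (isAdmissible_envelopeRing φ I).delta_mem _ y.2 z hz⟩, hB.cancel ?_, rfl⟩
      have hz' : (p : envelopeRing (p := p) φ I) *
          ⟨z, (isAdmissible_envelopeRing φ I).delta_mem _ y.2 z hz⟩ =
          envelopeFrob φ I y - y ^ p := Subtype.ext hz
      rw [← map_natCast g, ← map_mul]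
      conv_rhs => rw [map_natCast g, ← map_natCast g', ← map_mul]
      rw [hz', map_sub, map_sub, hg, hg', map_pow, map_pow, hy']
  ext x
  obtain ⟨y, hy, hyx⟩ := envelopeRing_le hadm x.2
  obtain rfl : y = x := Subtype.ext hyx
  exact hy

/-- The map `f` extends to `S[1/p] → B[1/p]`, and `B` embeds in `B[1/p]` by torsion freeness. The
preimage of `B` is admissible, so it contains the smallest admissible subring. -/
lemma exists_envelopeRing_lift (B : CrystallinePrism.{u} p) (f : S →+* B)
    (hf : ∀ x, f (φ x) = B.delta.frob (f x)) (hI : ∀ x ∈ I, f x ∈ pIdeal p B) :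
    ∃ g : envelopeRing (p := p) φ I →+* B,
      (∀ x, g (envelopeFrob φ I x) = B.delta.frob (g x)) ∧
      ∀ x, g (toEnvelopeRing φ I x) = f x := by
  have hB : TorsionFree p B := B.torsionFree
  let a := algebraMap B (Localization.Away (p : B))
  have ha : Function.Injective a := by
    refine IsLocalization.injective (M := Submonoid.powers (p : B)) _ ?_
    rw [Submonoid.powers_le, mem_nonZeroDivisors_iff_right]
    exact fun x hx => hB x (by rw [mul_comm, hx])
  have hu := isUnit_natCast_localization (p := p) (S := B)
  let f' : Localization.Away (p : S) →+* Localization.Away (p : B) :=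
    IsLocalization.map (M := Submonoid.powers (p : S)) (T := Submonoid.powers (p : B)) _ f (by
      rw [Submonoid.powers_le, Submonoid.mem_comap, map_natCast]
      exact Submonoid.mem_powers _)
  have hf' : ∀ x, f' (algebraMap S _ x) = a (f x) := fun x => IsLocalization.map_eq _ _
  have hφ : ∀ y, f' (locMap φ y) = locMap B.delta.frob (f' y) := by
    intro y
    refine RingHom.congr_fun (f := f'.comp (locMap φ)) (g := (locMap B.delta.frob).comp f')
      (IsLocalization.ringHom_ext (Submonoid.powers (p : S)) ?_) y
    ext x
    simp only [RingHom.comp_apply, locMap_algebraMap, hf', hf, a]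
  have hadm : IsAdmissible φ I (a.range.comap f') := by
    refine ⟨fun x => ⟨f x, (hf' x).symm⟩, fun x hx y hy => ?_, ?_⟩
    · obtain ⟨b, hb⟩ := mem_pIdeal.mp (hI x hx)
      refine ⟨b, hu.mul_left_cancel ?_⟩
      rw [← map_natCast f', ← map_mul f', hy, hf', hb, map_mul, map_natCast, map_natCast]
    · rintro y ⟨b, hb⟩ z hz
      refine ⟨B.delta.δ b, hu.mul_left_cancel ?_⟩
      rw [← map_natCast f', ← map_mul f', hz, map_sub, map_pow, hφ, ← hb, locMap_algebraMap,
        DeltaStructure.frob_apply, map_natCast, map_add, map_mul, map_pow, map_natCast]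
      ring
  have hle := envelopeRing_le hadm
  let e := RingEquiv.ofBijective a.rangeRestrict
    ⟨fun x y hxy => ha (congrArg Subtype.val hxy), a.rangeRestrict_surjective⟩
  let g : envelopeRing (p := p) φ I →+* B := e.symm.toRingHom.comp
    (f'.restrict _ _ fun y hy => hle hy)
  have hg : ∀ y, a (g y) = f' y := fun y => congrArg Subtype.val (e.apply_symm_apply _)
  refine ⟨g, fun x => ha ?_, fun x => ha ?_⟩
  · rw [hg, coe_envelopeFrob, hφ, ← hg, locMap_algebraMap]
  · rw [hg, coe_toEnvelopeRing, hf']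

/-- The prismatic envelope of `(S, φ, I)`. -/
def prismaticEnvelope : PrismaticEnvelope p S φ I where
  prism := envelopePrism φ I
  incl := (algebraMap _ (PCompletion p (envelopeRing (p := p) φ I))).comp (toEnvelopeRing φ I)
  incl_frob x := by
    rw [envelopePrism_frob, RingHom.comp_apply, RingHom.comp_apply, completionMap_algebraMap,
      envelopeFrob_toEnvelopeRing]
  incl_mem x hx := by
    have h := map_dvd (algebraMap _ (PCompletion p (envelopeRing (p := p) φ I)))
      (dvd_toEnvelopeRing (p := p) φ I hx)
    rw [map_natCast] at h
    exact mem_pIdeal.mpr h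
  universal B f hf hI := by
    obtain ⟨g, hg, hgf⟩ := exists_envelopeRing_lift φ I B f hf hI
    refine ⟨completionLift p g, ⟨IsDeltaHom.of_map_frob fun x => ?_, ?_⟩, ?_⟩
    · rw [envelopePrism_frob]
      refine RingHom.congr_fun (f := (completionLift p g).comp (completionMap p (envelopeFrob φ I)))
        (g := B.delta.frob.comp (completionLift p g)) (ringHom_ext_of_isHausdorff fun y => ?_) x
      simp [hg]
    · ext x
      simp [hgf]
    · rintro g' ⟨hg', hgf'⟩
      refine ringHom_ext_of_isHausdorff fun y => ?_
      rw [completionLift_algebraMap]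
      refine RingHom.congr_fun (g := g)
        (f := RingHom.comp (g' : PCompletion p (envelopeRing (p := p) φ I) →+* B) (algebraMap _ _))
        (envelopeRing_hom_ext φ I (fun x => ?_) hg fun x => ?_) y
      · have := hg'.map_frob (algebraMap (envelopeRing (p := p) φ I) (PCompletion p _) x)
        rw [envelopePrism_frob, completionMap_algebraMap] at this
        exact this
      · rw [hgf, ← hgf']
        rfl

end Envelope

/-! ### Lifting along `p`-completely étale maps -/

section EtaleLift

variable {p : ℕ} {Q R T : Type*} [CommRing Q] [CommRing R] [CommRing T] {q : Q →+* R}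

/-- The map from `S / p ^ n` to a ring in which `p ^ n = 0`. -/
def quotLift {n : ℕ} (hn : (p : T) ^ n = 0) (f : Q →+* T) : Q ⧸ pIdeal p Q ^ n →+* T :=
  Ideal.Quotient.lift _ f fun x hx => by
    obtain ⟨y, rfl⟩ := mem_pIdeal_pow.mp hx
    rw [map_mul, map_pow, map_natCast, hn, zero_mul]

@[simp]
lemma quotLift_mk {n : ℕ} (hn : (p : T) ^ n = 0) (f : Q →+* T) (x : Q) :
    quotLift hn f (Ideal.Quotient.mk _ x) = f x := Ideal.Quotient.lift_mk _ _ _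

@[simp]
lemma redModPow_mk (f : Q →+* T) (n : ℕ) (x : Q) :
    redModPow p f n (Ideal.Quotient.mk _ x) = Ideal.Quotient.mk _ (f x) :=
  Ideal.quotientMap_mk

@[simp]
lemma redMod_mk (f : Q →+* T) (x : Q) :
    redMod p f (Ideal.Quotient.mk _ x) = Ideal.Quotient.mk _ (f x) :=
  Ideal.quotientMap_mk

lemma natCast_pow_quotient (n : ℕ) : (p : T ⧸ pIdeal p T ^ n) ^ n = 0 := by
  rw [← map_natCast (Ideal.Quotient.mk (pIdeal p T ^ n)), ← map_pow,
    Ideal.Quotient.eq_zero_iff_mem, mem_pIdeal_pow]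

lemma isNilpotent_pIdeal {n : ℕ} (hn : (p : T) ^ n = 0) : IsNilpotent (pIdeal p T) :=
  ⟨n, by rw [pIdeal, Ideal.span_singleton_pow, hn]; simp⟩

/-- When `p ^ n = 0` in `T`, both maps factor through `R / p ^ n`, which is formally unramified over
`Q / p ^ n`, and the ideal `(p)` of `T` is nilpotent. -/
lemma IsPCompletelyEtale.hom_ext_of_pow_eq_zero (hq : IsPCompletelyEtale p q) {n : ℕ}
    (hn : (p : T) ^ n = 0) {g g' : R →+* T} (h : ∀ x, g (q x) = g' (q x))
    (h' : ∀ x, (p : T) ∣ g x - g' x) : g = g' := by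
  let : Algebra (Q ⧸ pIdeal p Q ^ n) (R ⧸ pIdeal p R ^ n) := (redModPow p q n).toAlgebra
  let : Algebra (Q ⧸ pIdeal p Q ^ n) T := (quotLift hn (g.comp q)).toAlgebra
  have : Algebra.Etale (Q ⧸ pIdeal p Q ^ n) (R ⧸ pIdeal p R ^ n) := hq n
  let G : R ⧸ pIdeal p R ^ n →ₐ[Q ⧸ pIdeal p Q ^ n] T :=
    { quotLift hn g with
      commutes' := fun x => by
        obtain ⟨x, rfl⟩ := Ideal.Quotient.mk_surjective x
        simp [RingHom.algebraMap_toAlgebra] }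
  let G' : R ⧸ pIdeal p R ^ n →ₐ[Q ⧸ pIdeal p Q ^ n] T :=
    { quotLift hn g' with
      commutes' := fun x => by
        obtain ⟨x, rfl⟩ := Ideal.Quotient.mk_surjective x
        simp [RingHom.algebraMap_toAlgebra, h] }
  have hG : G = G' := Algebra.FormallyUnramified.ext (I := pIdeal p T) (isNilpotent_pIdeal hn) (by
    intro x
    obtain ⟨x, rfl⟩ := Ideal.Quotient.mk_surjective x
    rw [mk_eq_mk_iff]
    exact h' x)
  ext x
  exact DFunLike.congr_fun hG (Ideal.Quotient.mk _ x)

lemma IsPCompletelyEtale.exists_lift_of_pow_eq_zero (hq : IsPCompletelyEtale p q) {n : ℕ}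
    (hn : (p : T) ^ n = 0) (f : Q →+* T) (g : R →+* T ⧸ pIdeal p T)
    (h : ∀ x, g (q x) = Ideal.Quotient.mk _ (f x)) :
    ∃ G : R →+* T, (∀ x, G (q x) = f x) ∧ ∀ x, Ideal.Quotient.mk _ (G x) = g x := by
  let : Algebra (Q ⧸ pIdeal p Q ^ n) (R ⧸ pIdeal p R ^ n) := (redModPow p q n).toAlgebra
  let : Algebra (Q ⧸ pIdeal p Q ^ n) T := (quotLift hn f).toAlgebra
  have : Algebra.Etale (Q ⧸ pIdeal p Q ^ n) (R ⧸ pIdeal p R ^ n) := hq n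
  have hn' : (p : T ⧸ pIdeal p T) ^ n = 0 := by
    rw [← map_natCast (Ideal.Quotient.mk (pIdeal p T)), ← map_pow, hn, map_zero]
  let g' : R ⧸ pIdeal p R ^ n →ₐ[Q ⧸ pIdeal p Q ^ n] T ⧸ pIdeal p T :=
    { quotLift hn' g with
      commutes' := fun x => by
        obtain ⟨x, rfl⟩ := Ideal.Quotient.mk_surjective x
        exact (quotLift_mk hn' g (q x)).trans (h x) }
  let G := Algebra.FormallySmooth.lift (pIdeal p T) (isNilpotent_pIdeal hn) g'
  refine ⟨(G : R ⧸ pIdeal p R ^ n →+* T).comp (Ideal.Quotient.mk _), fun x => ?_, fun x => ?_⟩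
  · have := G.commutes (Ideal.Quotient.mk _ x)
    simpa [RingHom.algebraMap_toAlgebra] using this
  · exact (Algebra.FormallySmooth.mk_lift (pIdeal p T) (isNilpotent_pIdeal hn) g' _).trans
      (quotLift_mk hn' _ _)

lemma IsPCompletelyEtale.hom_ext (hq : IsPCompletelyEtale p q) [IsHausdorff (pIdeal p T) T]
    {g g' : R →+* T} (h : ∀ x, g (q x) = g' (q x)) (h' : ∀ x, (p : T) ∣ g x - g' x) : g = g' := by
  ext x
  refine eq_of_forall_pow_dvd (p := p) fun n => mk_pow_eq_mk_pow_iff.mp ?_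
  refine RingHom.congr_fun (hq.hom_ext_of_pow_eq_zero (natCast_pow_quotient n)
    (g := (Ideal.Quotient.mk (pIdeal p T ^ n)).comp g)
    (g' := (Ideal.Quotient.mk (pIdeal p T ^ n)).comp g') (fun y => ?_) fun y => ?_) x
  · simp [h]
  · simpa using map_dvd (Ideal.Quotient.mk (pIdeal p T ^ n)) (h' y)

/-- Formal smoothness lifts `g` to each `T / p ^ n`, uniqueness of these lifts makes them
compatible, and completeness of `T` provides their limit. -/
lemma IsPCompletelyEtale.exists_lift (hq : IsPCompletelyEtale p q) [IsAdicComplete (pIdeal p T) T]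
    (f : Q →+* T) (g : R →+* T ⧸ pIdeal p T) (h : ∀ x, g (q x) = Ideal.Quotient.mk _ (f x)) :
    ∃ G : R →+* T, (∀ x, G (q x) = f x) ∧ ∀ x, Ideal.Quotient.mk _ (G x) = g x := by
  have hex := fun n : ℕ => hq.exists_lift_of_pow_eq_zero (natCast_pow_quotient n)
    ((Ideal.Quotient.mk (pIdeal p T ^ n)).comp f)
    ((redMod p (Ideal.Quotient.mk (pIdeal p T ^ n))).comp g) (fun x => by simp [h])
  choose G hGq hGg using hex
  have hcompat : ∀ {m n : ℕ} (hle : m ≤ n),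
      (Ideal.Quotient.factorPow (pIdeal p T) hle).comp (G n) = G m := by
    intro m n hle
    refine hq.hom_ext_of_pow_eq_zero (natCast_pow_quotient m) (fun x => ?_) fun x => ?_
    · rw [RingHom.comp_apply, hGq, hGq]
      simp [Ideal.Quotient.factorPow]
    · obtain ⟨t, ht⟩ := Ideal.Quotient.mk_surjective (g x)
      have h1 := hGg n x
      have h2 := hGg m x
      rw [RingHom.comp_apply, ← ht, redMod_mk, mk_eq_mk_iff] at h1 h2
      have h3 := map_dvd (Ideal.Quotient.factorPow (pIdeal p T) hle) h1
      rw [map_natCast, map_sub, Ideal.Quotient.factorPow, Ideal.Quotient.factor_mk] at h3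
      have h4 := dvd_sub h3 h2
      rwa [sub_sub_sub_cancel_right] at h4
  refine ⟨IsAdicComplete.liftRingHom (pIdeal p T) G hcompat, fun x => ?_, fun x => ?_⟩
  · refine eq_of_forall_pow_dvd (p := p) fun n => mk_pow_eq_mk_pow_iff.mp ?_
    rw [IsAdicComplete.mk_liftRingHom, hGq, RingHom.comp_apply]
  · obtain ⟨t, ht⟩ := Ideal.Quotient.mk_surjective (g x)
    -- Level `n = 1` already determines the limit modulo `p`.
    have h1 := hGg 1 x
    rw [RingHom.comp_apply, ← ht, redMod_mk, ← IsAdicComplete.mk_liftRingHom (pIdeal p T) G hcompat,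
      mk_eq_mk_iff, ← map_sub] at h1
    rw [← ht, mk_eq_mk_iff]
    obtain ⟨c, hc⟩ := h1
    obtain ⟨c, rfl⟩ := Ideal.Quotient.mk_surjective c
    rw [← map_natCast (Ideal.Quotient.mk (pIdeal p T ^ 1)), ← map_mul, mk_pow_eq_mk_pow_iff,
      pow_one] at hc
    exact (dvd_iff_dvd_of_dvd_sub hc).mpr (dvd_mul_right _ _)

/-- The hypotheses say that multiplication by `a` followed by multiplication by `b` is exact on `B`;
tensoring with the flat module `M` keeps it exact. -/
lemma exists_eq_smul_of_smul_eq_zero {B M : Type*} [CommRing B] [AddCommGroup M] [Module B M]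
    [Module.Flat B M] {a b : B} (hab : a * b = 0) (h : ∀ x, b * x = 0 → ∃ y, x = a * y) {m : M}
    (hm : b • m = 0) : ∃ m', m = a • m' := by
  have hex : Function.Exact (a • LinearMap.id : B →ₗ[B] B) (b • LinearMap.id : B →ₗ[B] B) := by
    intro x
    constructor
    · intro hx
      obtain ⟨y, hy⟩ := h x (by simpa using hx)
      exact ⟨y, by simp [hy]⟩
    · rintro ⟨y, rfl⟩
      simp only [LinearMap.smul_apply, LinearMap.id_apply, smul_eq_mul]
      rw [← mul_assoc, mul_comm b, hab, zero_mul]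
  have hex' := Module.Flat.lTensor_exact M hex
  rw [LinearMap.lTensor_smul, LinearMap.lTensor_smul, LinearMap.lTensor_id] at hex'
  obtain ⟨w, hw⟩ := (hex' (m ⊗ₜ 1)).mp (by
    rw [LinearMap.smul_apply, LinearMap.id_apply, TensorProduct.smul_tmul', hm,
      TensorProduct.zero_tmul])
  have h2 := congrArg (TensorProduct.rid B M) hw
  rw [LinearMap.smul_apply, LinearMap.id_apply, map_smul, TensorProduct.rid_tmul, one_smul] at h2
  exact ⟨_, h2.symm⟩

/-- In `Q / p ^ (n + 1)` the annihilator of `p` is generated by `p ^ n`. By flatness the same holds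
in `R / p ^ (n + 1)`, so `p x = 0` implies that `x` is divisible by every `p ^ n`. -/
lemma IsPCompletelyEtale.torsionFree (hq : IsPCompletelyEtale p q) [IsHausdorff (pIdeal p R) R]
    (hQ : TorsionFree p Q) : TorsionFree p R := by
  intro x hx
  refine eq_zero_of_forall_pow_dvd (p := p) fun n => ?_
  let : Algebra (Q ⧸ pIdeal p Q ^ (n + 1)) (R ⧸ pIdeal p R ^ (n + 1)) :=
    (redModPow p q (n + 1)).toAlgebra
  have : Algebra.Etale (Q ⧸ pIdeal p Q ^ (n + 1)) (R ⧸ pIdeal p R ^ (n + 1)) := hq (n + 1)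
  obtain ⟨w, hw⟩ := exists_eq_smul_of_smul_eq_zero (B := Q ⧸ pIdeal p Q ^ (n + 1))
    (M := R ⧸ pIdeal p R ^ (n + 1)) (a := (p : Q ⧸ pIdeal p Q ^ (n + 1)) ^ n)
    (b := (p : Q ⧸ pIdeal p Q ^ (n + 1))) (m := Ideal.Quotient.mk _ x)
    (by rw [← pow_succ, natCast_pow_quotient]) (fun y hy => by
      obtain ⟨y, rfl⟩ := Ideal.Quotient.mk_surjective y
      rw [← map_natCast (Ideal.Quotient.mk (pIdeal p Q ^ (n + 1))), ← map_mul,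
        Ideal.Quotient.eq_zero_iff_mem, mem_pIdeal_pow] at hy
      obtain ⟨z, hz⟩ := hy
      refine ⟨Ideal.Quotient.mk _ z, ?_⟩
      rw [hQ.cancel (x := y) (y := (p : Q) ^ n * z) (by rw [hz]; ring)]
      simp) (by
      rw [Algebra.smul_def, map_natCast,
        ← map_natCast (Ideal.Quotient.mk (pIdeal p R ^ (n + 1))), ← map_mul, hx, map_zero])
  obtain ⟨w, rfl⟩ := Ideal.Quotient.mk_surjective w
  rw [Algebra.smul_def, map_pow, map_natCast,
    ← map_natCast (Ideal.Quotient.mk (pIdeal p R ^ (n + 1))), ← map_pow, ← map_mul,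
    mk_pow_eq_mk_pow_iff] at hw
  exact (dvd_iff_dvd_of_dvd_sub ((pow_dvd_pow (p : R) (Nat.le_succ n)).trans hw)).mpr
    (dvd_mul_right _ _)

end EtaleLift

/-! ### The completed torus -/

section Torus

variable {p : ℕ} {A : CrystallinePrism.{u} p} {d : ℕ}

lemma torsionFree_completedTorus : TorsionFree p (CompletedTorus A d) := by
  refine TorsionFree.pCompletion fun x hx => ?_
  ext n
  refine A.torsionFree _ ?_
  have h := congrArg (fun y => y.coeff n) hx
  simpa [← nsmul_eq_mul] using h

variable {T : Type*} [CommRing T]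

lemma completedTorus_hom_ext [IsHausdorff (pIdeal p T) T] {f g : CompletedTorus A d →+* T}
    (hA : ∀ a : A, f (algebraMap A _ a) = g (algebraMap A _ a))
    (hX : ∀ i, f (CompletedTorus.X A i) = g (CompletedTorus.X A i)) : f = g := by
  refine ringHom_ext_of_isHausdorff fun x => ?_
  refine RingHom.congr_fun (f := f.comp (algebraMap (AddMonoidAlgebra A (Fin d → ℤ)) _))
    (g := g.comp (algebraMap (AddMonoidAlgebra A (Fin d → ℤ)) _)) ?_ x
  refine AddMonoidAlgebra.ringHom_ext (fun a => hA a) fun n => ?_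
  let φ : Multiplicative (Fin d → ℤ) →* CompletedTorus A d :=
    (algebraMap (AddMonoidAlgebra A (Fin d → ℤ)) (CompletedTorus A d)).toMonoidHom.comp
      (AddMonoidAlgebra.of A (Fin d → ℤ))
  have h : ∀ i, ((f : CompletedTorus A d →* T).comp φ) (.ofAdd (Pi.single i 1)) =
      ((g : CompletedTorus A d →* T).comp φ) (.ofAdd (Pi.single i 1)) := hX
  have hn : n = ∑ i, n i • Pi.single i 1 := by
    conv_lhs => rw [← Finset.univ_sum_single n]
    exact Finset.sum_congr rfl fun i _ => by rw [← Pi.single_smul, smul_eq_mul, mul_one]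
  have h2 : ((f : CompletedTorus A d →* T).comp φ) (.ofAdd n) =
      ((g : CompletedTorus A d →* T).comp φ) (.ofAdd n) := by
    rw [hn, ofAdd_sum, map_prod, map_prod]
    refine Finset.prod_congr rfl fun i _ => ?_
    rw [ofAdd_zsmul]
    -- Restricted to the powers of `X_i`, each side is a monoid homomorphism out of `ℤ`, so its
    -- value at `1` determines it.
    refine DFunLike.congr_fun (f := (((f : CompletedTorus A d →* T).comp φ).comp
      (zpowersHom _ (Multiplicative.ofAdd (Pi.single i (1 : ℤ) : Fin d → ℤ)))))
      (g := (((g : CompletedTorus A d →* T).comp φ).comp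
      (zpowersHom _ (Multiplicative.ofAdd (Pi.single i (1 : ℤ) : Fin d → ℤ)))))
      (MonoidHom.ext_mint ?_) (Multiplicative.ofAdd (n i))
    simpa using h i
  exact h2

lemma exists_completedTorus_lift [IsAdicComplete (pIdeal p T) T] (f : A →+* T) (u : Fin d → T)
    (hu : ∀ i, IsUnit (u i)) : ∃ g : CompletedTorus A d →+* T,
      (∀ a : A, g (algebraMap A _ a) = f a) ∧ ∀ i, g (CompletedTorus.X A i) = u i := by
  choose v hv using hu
  let F : Multiplicative (Fin d → ℤ) →* T :=
    { toFun := fun n => ((∏ i, v i ^ (n.toAdd i) : Tˣ) : T)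
      map_one' := by simp
      map_mul' := fun m n => by
        rw [← Units.val_mul, ← Finset.prod_mul_distrib]
        simp [zpow_add] }
  let : Algebra A T := f.toAlgebra
  refine ⟨completionLift p (AddMonoidAlgebra.lift A T _ F : AddMonoidAlgebra A (Fin d → ℤ) →+* T),
    fun a => ?_, fun i => ?_⟩
  · rw [algebraMap_pCompletion, completionLift_algebraMap]
    exact AlgHom.commutes (AddMonoidAlgebra.lift A T (Fin d → ℤ) F) a
  · rw [CompletedTorus.X, completionLift_algebraMap, ← hv]
    simp [F, Pi.single_apply, apply_ite (Units.val : Tˣ → T)]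

lemma isUnit_completedTorus_X (i : Fin d) : IsUnit (CompletedTorus.X A i) := by
  have h : CompletedTorus.X A i * algebraMap (AddMonoidAlgebra A (Fin d → ℤ)) _
      (AddMonoidAlgebra.single (-Pi.single i 1) 1) = 1 := by
    rw [CompletedTorus.X, ← map_mul, AddMonoidAlgebra.single_mul_single]
    simp
    rfl
  exact IsUnit.of_mul_eq_one _ h

end Torus

/-! ### Divided power polynomial rings over torsion free rings -/

section DividedPower

open DividedPowerAlgebra Nat

variable {S T : Type*} [CommRing S] [CommRing T] {d : ℕ}

lemma NatTorsionFree.cancel (hT : NatTorsionFree T) {n : ℕ} (hn : n ≠ 0) {x y : T}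
    (h : (n : T) * x = n * y) : x = y :=
  sub_eq_zero.mp (hT n _ hn (by rw [mul_sub, h, sub_self]))

/-- All powers `x ^ n` are divisible by `n!`. -/
def HasDividedPowers (x : T) : Prop := ∀ n : ℕ, (n ! : T) ∣ x ^ n

lemma hasDividedPowers_zero : HasDividedPowers (0 : T) := by
  intro n
  cases n with
  | zero => simp
  | succ n => simp

lemma HasDividedPowers.add {x y : T} (hx : HasDividedPowers x) (hy : HasDividedPowers y) :
    HasDividedPowers (x + y) := by
  intro n
  rw [add_pow]
  refine Finset.dvd_sum fun k hk => ?_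
  have h := Nat.choose_mul_factorial_mul_factorial (Finset.mem_range_succ_iff.mp hk)
  rw [← h, mul_assoc, mul_comm (n.choose k), Nat.cast_mul, Nat.cast_mul]
  exact mul_dvd_mul (mul_dvd_mul (hx k) (hy _)) dvd_rfl

lemma HasDividedPowers.mul_left {x : T} (hx : HasDividedPowers x) (a : T) :
    HasDividedPowers (a * x) := by
  intro n
  rw [mul_pow]
  exact (hx n).mul_left _

lemma HasDividedPowers.sum {ι : Type*} (s : Finset ι) {x : ι → T}
    (hx : ∀ i ∈ s, HasDividedPowers (x i)) : HasDividedPowers (∑ i ∈ s, x i) :=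
  Finset.sum_induction x HasDividedPowers (fun _ _ => .add) hasDividedPowers_zero hx

/-- In a torsion free ring `x ^ n / n!` is unique once it exists, so the divided power relations may
be verified after multiplication by factorials, where they become identities between ordinary
powers. -/
lemma exists_dividedPowerAlgebra_lift (hT : NatTorsionFree T) (f : S →+* T) (y : Fin d → T)
    (hy : ∀ i, HasDividedPowers (y i)) :
    ∃ g : DividedPowerAlgebra S (Fin d → S) →+* T,
      (∀ s, g (algebraMap S _ s) = f s) ∧ ∀ i, g (dp S 1 (Pi.single i 1)) = y i := by
  let : Algebra S T := f.toAlgebra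
  let l : (Fin d → S) →ₗ[S] T := Fintype.linearCombination S y
  have hl : ∀ m, HasDividedPowers (l m) := fun m => by
    simp only [l, Fintype.linearCombination_apply, Algebra.smul_def]
    exact HasDividedPowers.sum _ fun i _ => (hy i).mul_left _
  choose γ hγ using hl
  have hfac : ∀ n : ℕ, n ! ≠ 0 := Nat.factorial_ne_zero
  have h_zero : ∀ m, γ m 0 = 1 := fun m => by simpa using (hγ m 0).symm
  have h_smul : ∀ (n : ℕ) (r : S) (m : Fin d → S), γ (r • m) n = r ^ n • γ m n := fun n r m => by
    refine hT.cancel (hfac n) ?_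
    rw [← hγ, map_smul, smul_pow, mul_smul_comm, ← hγ]
  have h_mul : ∀ n k m, γ m n * γ m k = (n + k).choose n • γ m (n + k) := fun n k m => by
    refine hT.cancel (mul_ne_zero (hfac n) (hfac k)) ?_
    have h := Nat.add_choose_mul_factorial_mul_factorial n k
    calc ((n ! * k ! : ℕ) : T) * (γ m n * γ m k) = l m ^ n * l m ^ k := by
          rw [hγ m n, hγ m k]; push_cast; ring
      _ = ((n + k)! : T) * γ m (n + k) := by rw [← pow_add, hγ m (n + k)]
      _ = _ := by rw [← h, nsmul_eq_mul, Nat.choose_symm_add]; push_cast; ring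
  have h_add : ∀ n u v, γ (u + v) n =
      ∑ k ∈ Finset.HasAntidiagonal.antidiagonal n, γ u k.1 * γ v k.2 :=
      fun n u v => by
    refine hT.cancel (hfac n) ?_
    rw [← hγ, map_add, (Commute.all _ _).add_pow', Finset.mul_sum]
    refine Finset.sum_congr rfl fun k hk => ?_
    obtain rfl := Finset.HasAntidiagonal.mem_antidiagonal.mp hk
    rw [hγ u, hγ v, nsmul_eq_mul, ← Nat.add_choose_mul_factorial_mul_factorial,
      Nat.choose_symm_add]
    push_cast
    ring
  let g : DividedPowerAlgebra S (Fin d → S) →ₐ[S] T :=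
    lift' (f := fun nm : ℕ × (Fin d → S) => γ nm.2 nm.1) h_zero h_smul h_mul h_add
  refine ⟨g, g.commutes, fun i => ?_⟩
  have h1 := hγ (Pi.single i 1) 1
  simp only [pow_one, Nat.factorial_one, Nat.cast_one, one_mul] at h1
  rw [RingHom.coe_coe, lift'_apply_dp, ← h1]
  simp [l]

lemma span_range_single_eq_top :
    Submodule.span S (Set.range fun i : Fin d => (Pi.single i 1 : Fin d → S)) = ⊤ := by
  convert (Pi.basisFun S (Fin d)).span_eq
  rw [Pi.basisFun_apply]

lemma dividedPowerAlgebra_hom_ext {g g' : DividedPowerAlgebra S (Fin d → S) →+* T}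
    (h : ∀ s, g (algebraMap S _ s) = g' (algebraMap S _ s))
    (h' : ∀ n i, g (dp S n (Pi.single i 1)) = g' (dp S n (Pi.single i 1))) : g = g' := by
  refine RingHom.ext fun x => ?_
  have hx : x ∈ (⊤ : Submodule S (DividedPowerAlgebra S (Fin d → S))) := Submodule.mem_top
  rw [← submodule_span_prod_dp_eq_top span_range_single_eq_top] at hx
  induction hx using Submodule.span_induction with
  | mem x hx =>
    obtain ⟨n, rfl⟩ := hx
    simp [Finsupp.prod, h']
  | zero => simp
  | add x y _ _ hx hy => rw [map_add, map_add, hx, hy]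
  | smul a x _ hx => rw [Algebra.smul_def, map_mul, map_mul, h, hx]

lemma dividedPowerAlgebra_hom_ext_of_natTorsionFree (hT : NatTorsionFree T)
    {g g' : DividedPowerAlgebra S (Fin d → S) →+* T}
    (h : ∀ s, g (algebraMap S _ s) = g' (algebraMap S _ s))
    (h' : ∀ i, g (dp S 1 (Pi.single i 1)) = g' (dp S 1 (Pi.single i 1))) : g = g' := by
  refine dividedPowerAlgebra_hom_ext h fun n i => hT.cancel (Nat.factorial_ne_zero n) ?_
  have key : ∀ f : DividedPowerAlgebra S (Fin d → S) →+* T,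
      (n ! : T) * f (dp S n (Pi.single i 1)) = f (dp S 1 (Pi.single i 1)) ^ n := fun f => by
    rw [← map_natCast f, ← map_mul, natFactorial_mul_dp_eq, map_pow]
  rw [key, key, h']

/-- Over the total ring of fractions `K` all nonzero integers are invertible, so the algebra maps to
`K[X_1, …, X_d]` by `Y_i^[n] ↦ X_i ^ n / n!`. The spanning products of divided powers go to unit
multiples of distinct monomials, which makes the map injective. -/
lemma NatTorsionFree.dividedPowerAlgebra (hS : NatTorsionFree S) :
    NatTorsionFree (DividedPowerAlgebra S (Fin d → S)) := by
  let K := FractionRing S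
  have hK : ∀ n : ℕ, n ≠ 0 → IsUnit (n : K) := fun n hn => by
    rw [← map_natCast (algebraMap S K)]
    refine IsLocalization.map_units (M := nonZeroDivisors S) K ⟨(n : S), ?_⟩
    rw [mem_nonZeroDivisors_iff_right]
    exact fun x hx => hS n x hn (by rw [mul_comm, hx])
  have hK' : ∀ n : ℕ, n ≠ 0 → IsUnit (n : MvPolynomial (Fin d) K) := fun n hn => by
    rw [← map_natCast (algebraMap K (MvPolynomial (Fin d) K))]
    exact (hK n hn).map _
  have hP : NatTorsionFree (MvPolynomial (Fin d) K) := fun n x hn hx =>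
    (hK' n hn).mul_left_cancel (by rw [hx, mul_zero])
  obtain ⟨g, hg, hgX⟩ := exists_dividedPowerAlgebra_lift hP
    ((MvPolynomial.C : K →+* MvPolynomial (Fin d) K).comp (algebraMap S K)) MvPolynomial.X
    (fun i n => (hK' _ (Nat.factorial_ne_zero n)).dvd)
  choose v hv using hK
  have hdp : ∀ n i, g (dp S n (Pi.single i 1)) =
      MvPolynomial.C (↑(v _ (Nat.factorial_ne_zero n))⁻¹ : K) * MvPolynomial.X i ^ n := by
    intro n i
    refine (hK' _ (Nat.factorial_ne_zero n)).mul_left_cancel ?_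
    have h1 : (n ! : MvPolynomial (Fin d) K) * g (dp S n (Pi.single i 1)) =
        MvPolynomial.X i ^ n := by
      rw [← map_natCast g, ← map_mul, natFactorial_mul_dp_eq, map_pow, hgX]
    have h2 : (n ! : MvPolynomial (Fin d) K) *
        MvPolynomial.C (↑(v _ (Nat.factorial_ne_zero n))⁻¹ : K) = 1 := by
      rw [← map_natCast (MvPolynomial.C : K →+* MvPolynomial (Fin d) K), ← map_mul,
        ← hv _ (Nat.factorial_ne_zero n), Units.mul_inv, map_one]
    rw [h1, ← mul_assoc, h2, one_mul]
  have hmon : ∀ n : Fin d →₀ ℕ, ∃ w : Kˣ, g (n.prod fun i k => dp S k (Pi.single i 1)) =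
      MvPolynomial.monomial n (w : K) := by
    intro n
    refine ⟨∏ i ∈ n.support, (v _ (Nat.factorial_ne_zero (n i)))⁻¹, ?_⟩
    rw [Finsupp.prod, map_prod, MvPolynomial.monomial_eq, Finsupp.prod, Units.coe_prod, map_prod,
      ← Finset.prod_mul_distrib]
    exact Finset.prod_congr rfl fun i _ => hdp _ _
  have hinj : Function.Injective g := by
    rw [injective_iff_map_eq_zero]
    intro x hx
    have hx' : x ∈ (⊤ : Submodule S (DividedPowerAlgebra S (Fin d → S))) := Submodule.mem_top
    rw [← submodule_span_prod_dp_eq_top span_range_single_eq_top,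
      Finsupp.mem_span_range_iff_exists_finsupp] at hx'
    obtain ⟨c, rfl⟩ := hx'
    have hc : c = 0 := by
      ext n
      choose w hw using hmon
      have h0 := congrArg (MvPolynomial.coeff n) hx
      rw [Finsupp.sum, map_sum, MvPolynomial.coeff_sum, Finset.sum_eq_single n] at h0
      · rw [Algebra.smul_def, map_mul, hg, hw, RingHom.comp_apply, MvPolynomial.C_mul_monomial,
          MvPolynomial.coeff_monomial, if_pos rfl, MvPolynomial.coeff_zero] at h0
        have h1 := (w n).isUnit.mul_right_cancel (h0.trans (zero_mul _).symm)
        exact IsFractionRing.injective S K (by rw [h1, Finsupp.zero_apply, map_zero])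
      · intro m _ hm
        rw [Algebra.smul_def, map_mul, hg, hw, RingHom.comp_apply, MvPolynomial.C_mul_monomial,
          MvPolynomial.coeff_monomial, if_neg hm]
      · intro hn
        rw [Finsupp.notMem_support_iff.mp hn]
        simp
    rw [hc]
    simp
  intro n x hn hx
  refine hinj ?_
  rw [map_zero]
  exact hP n _ hn (by rw [← map_natCast g, ← map_mul, hx, map_zero])

lemma NatTorsionFree.torsionFree {p : ℕ} [hp : Fact p.Prime] (hT : NatTorsionFree T) :
    TorsionFree p T := fun x hx => hT p x hp.out.ne_zero hx

end DividedPower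

/-! ### Divided powers and Frobenius lifts -/

section PDFrobenius

open DividedPowerAlgebra Nat

variable {p : ℕ} [hp : Fact p.Prime]

section

variable {T : Type*} [CommRing T] [IsAdicComplete (pIdeal p T) T]

/-- The `p`-adic valuation of `n!` is strictly less than `n` for `n ≠ 0`, and the prime-to-`p` part
of `n!` is a unit. The strict inequality provides the extra factor `p`. -/
lemma factorial_mul_dvd_pow {n : ℕ} (hn : n ≠ 0) : (n ! : T) * p ∣ (p : T) ^ n := by
  obtain ⟨k, m, hm, hk⟩ := Nat.exists_eq_pow_mul_and_not_dvd (Nat.factorial_ne_zero n) p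
    hp.out.ne_one
  have hu : IsUnit (m : T) := isUnit_natCast_of_coprime
    ((Nat.Prime.coprime_iff_not_dvd hp.out).mpr hm).symm
  have hkn : k < n := lt_of_le_of_lt
    ((padicValNat_dvd_iff_le (Nat.factorial_ne_zero n)).mp ⟨m, hk⟩)
    (padicValNat_factorial_lt_of_ne_zero p hn)
  rw [hk, Nat.cast_mul, Nat.cast_pow, mul_right_comm, ← pow_succ, hu.mul_right_dvd]
  exact pow_dvd_pow _ hkn

lemma hasDividedPowers_of_dvd {x : T} (hx : (p : T) ∣ x) : HasDividedPowers x := by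
  intro n
  rcases eq_or_ne n 0 with rfl | hn
  · simp
  · exact (dvd_of_mul_right_dvd (factorial_mul_dvd_pow hn)).trans (pow_dvd_pow_of_dvd hx n)

/-- Legendre's recursion: the `p`-adic valuation of `n!` is `n / p` plus that of `(n / p)!`. -/
lemma factorial_dvd_pow_mul_factorial (n : ℕ) : (n ! : T) ∣ (p : T) ^ (n / p) * (n / p)! := by
  obtain ⟨k, m, hm, hk⟩ := Nat.exists_eq_pow_mul_and_not_dvd (Nat.factorial_ne_zero n) p
    hp.out.ne_one
  have hu : IsUnit (m : T) := isUnit_natCast_of_coprime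
    ((Nat.Prime.coprime_iff_not_dvd hp.out).mpr hm).symm
  have hk' : k ≤ n / p + padicValNat p (n / p)! := by
    have h1 := (padicValNat_dvd_iff_le (Nat.factorial_ne_zero n)).mp ⟨m, hk⟩
    have h2 := padicValNat_factorial_mul_add (p := p) (n / p) (Nat.mod_lt n hp.out.pos)
    rw [Nat.div_add_mod, padicValNat_factorial_mul] at h2
    omega
  have h : p ^ k ∣ p ^ (n / p) * (n / p)! :=
    (pow_dvd_pow p hk').trans (by rw [pow_add]; exact mul_dvd_mul_left _ pow_padicValNat_dvd)
  rw [hk, Nat.cast_mul, hu.mul_right_dvd]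
  exact_mod_cast Nat.cast_dvd_cast (α := T) h

/-- In a crystalline prism, `φ(x) ∈ (p)` implies that `x` has all divided powers. -/
lemma hasDividedPowers_of_dvd_frob {B : CrystallinePrism.{u} p} {x : B}
    (hx : (p : B) ∣ B.delta.frob x) : HasDividedPowers x := by
  have hB : TorsionFree p B := B.torsionFree
  intro n
  induction n using Nat.strong_induction_on generalizing x with
  | _ n ih =>
    have hxp : (p : B) ∣ x ^ p := (dvd_iff_dvd_of_dvd_sub (B.delta.dvd_frob_sub_pow x)).mp hx
    obtain ⟨w, hw⟩ := hxp
    -- With `φ(x) = p v` and `x ^ p = p w`, one gets `p φ(w) = p ^ p v ^ p`, which is divisible by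
    -- `p ^ 2`. So `w` satisfies the hypothesis on `x`, and the induction can continue with `w` and
    -- `n / p`.
    have hwf : (p : B) ∣ B.delta.frob w := by
      obtain ⟨v, hv⟩ := hx
      obtain ⟨c, hc⟩ := pow_dvd_pow (p : B) hp.out.two_le
      refine ⟨c * v ^ p, hB.cancel ?_⟩
      have h := congrArg B.delta.frob hw
      rw [map_pow, map_mul, map_natCast, hv, mul_pow, hc] at h
      rw [← h]
      ring
    rcases eq_or_ne n 0 with rfl | hn
    · simp
    obtain ⟨c, hc⟩ := ih (n / p) (Nat.div_lt_self (Nat.pos_of_ne_zero hn) hp.out.one_lt) hwf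
    have h1 : x ^ n = (p : B) ^ (n / p) * (n / p)! * (c * x ^ (n % p)) := by
      conv_lhs => rw [← Nat.div_add_mod n p, pow_add, pow_mul, hw, mul_pow, hc]
      ring
    rw [h1]
    exact (factorial_dvd_pow_mul_factorial n).mul_right _

end

/-- The `p`-th power of `Y^[n]` is `(p n)! / (n!) ^ p` times `Y^[p n]`, and for `n ≠ 0` this
coefficient is a multiple of `p!`. -/
lemma dvd_dp_pow {S : Type*} [CommRing S] (hS : NatTorsionFree S) {d : ℕ} {n : ℕ} (hn : n ≠ 0)
    (i : Fin d) : (p : DividedPowerAlgebra S (Fin d → S)) ∣ dp S n (Pi.single i 1) ^ p := by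
  set y : DividedPowerAlgebra S (Fin d → S) := dp S n (Pi.single i 1) with hy
  have h : y ^ p = ((Nat.uniformBell p n * p ! : ℕ) : DividedPowerAlgebra S (Fin d → S)) *
      dp S (p * n) (Pi.single i 1) := by
    refine hS.dividedPowerAlgebra.cancel (pow_ne_zero p (Nat.factorial_ne_zero n)) ?_
    rw [Nat.cast_pow, ← mul_pow, hy, natFactorial_mul_dp_eq, ← pow_mul, mul_comm n,
      ← natFactorial_mul_dp_eq, ← Nat.uniformBell_mul_eq p hn]
    push_cast
    ring
  rw [h]
  exact (Nat.cast_dvd_cast ((Nat.dvd_factorial hp.out.pos le_rfl).mul_left _)).mul_right _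

variable (D : CrystallinePrism.{u} p) (d : ℕ)

lemma CrystallinePrism.natTorsionFree : NatTorsionFree D :=
  TorsionFree.natTorsionFree (p := p) D.torsionFree

lemma torsionFree_completedPDPoly : TorsionFree p (CompletedPDPoly p D d) :=
  D.natTorsionFree.dividedPowerAlgebra.torsionFree.pCompletion

variable {d}

lemma exists_completedPDPoly_lift {T : Type*} [CommRing T] [IsAdicComplete (pIdeal p T) T]
    (hT : TorsionFree p T) (f : D →+* T) (y : Fin d → T) (hy : ∀ i, HasDividedPowers (y i)) :
    ∃ g : CompletedPDPoly p D d →+* T,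
      (∀ s, g (algebraMap D _ s) = f s) ∧ ∀ i, g (CompletedPDPoly.Y p D i) = y i := by
  obtain ⟨g, hg, hgy⟩ := exists_dividedPowerAlgebra_lift hT.natTorsionFree f y hy
  refine ⟨completionLift p g, fun s => ?_, fun i => ?_⟩
  · rw [algebraMap_pCompletion, completionLift_algebraMap, hg]
  · rw [CompletedPDPoly.Y, completionLift_algebraMap, hgy]

variable {D}

lemma completedPDPoly_hom_ext {T : Type*} [CommRing T] [IsAdicComplete (pIdeal p T) T]
    (hT : TorsionFree p T) {g g' : CompletedPDPoly p D d →+* T}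
    (h : ∀ s, g (algebraMap D _ s) = g' (algebraMap D _ s))
    (h' : ∀ i, g (CompletedPDPoly.Y p D i) = g' (CompletedPDPoly.Y p D i)) : g = g' :=
  ringHom_ext_of_isHausdorff fun x => RingHom.congr_fun
    (f := g.comp (algebraMap (DividedPowerAlgebra D (Fin d → D)) _))
    (g := g'.comp (algebraMap (DividedPowerAlgebra D (Fin d → D)) _))
    (dividedPowerAlgebra_hom_ext_of_natTorsionFree hT.natTorsionFree h h') x

/-- Modulo `p` the map `x ↦ x ^ p` is a ring homomorphism, so being a Frobenius lift can be tested
on scalars and on the divided powers of the variables. -/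
lemma dvd_map_sub_pow_of_dividedPowerAlgebra {S T : Type*} [CommRing S] [CommRing T]
    {F a : DividedPowerAlgebra S (Fin d → S) →+* T}
    (h : ∀ s, (p : T) ∣ F (algebraMap S _ s) - a (algebraMap S _ s) ^ p)
    (h' : ∀ n i, (p : T) ∣ F (dp S n (Pi.single i 1)) - a (dp S n (Pi.single i 1)) ^ p)
    (x : DividedPowerAlgebra S (Fin d → S)) : (p : T) ∣ F x - a x ^ p := by
  let m := Ideal.Quotient.mk (pIdeal p T)
  let f : T ⧸ pIdeal p T →+* T ⧸ pIdeal p T :=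
    { toFun := fun x => x ^ p
      map_one' := one_pow p
      map_mul' := fun x y => mul_pow x y p
      map_zero' := zero_pow hp.out.ne_zero
      map_add' := fun x y => by
        obtain ⟨x, rfl⟩ := Ideal.Quotient.mk_surjective x
        obtain ⟨y, rfl⟩ := Ideal.Quotient.mk_surjective y
        rw [← map_add, ← map_pow, ← map_pow, ← map_pow, ← map_add, mk_eq_mk_iff]
        exact dvd_add_pow_sub x y }
  have key : (m.comp F) = f.comp (m.comp a) :=
    dividedPowerAlgebra_hom_ext (fun s => mk_eq_mk_iff.mpr (h s))
      fun n i => mk_eq_mk_iff.mpr (h' n i)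
  exact mk_eq_mk_iff.mp (RingHom.congr_fun key x)

/-- Multiples of `p` have divided powers, so `Y_i ↦ p z_i` extends to a ring map. For `n ≠ 0` it
sends `Y_i^[n]` to `p ^ n z_i ^ n / n!`, a multiple of `p`, and `(Y_i^[n]) ^ p` is a multiple of `p`
as well. -/
lemma exists_completedPDPoly_frob (z : Fin d → CompletedPDPoly p D d) :
    ∃ F : CompletedPDPoly p D d →+* CompletedPDPoly p D d,
      (∀ s, F (algebraMap D _ s) = algebraMap D _ (D.delta.frob s)) ∧
      (∀ i, F (CompletedPDPoly.Y p D i) = p * z i) ∧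
      ∀ x, (p : CompletedPDPoly p D d) ∣ F x - x ^ p := by
  have hP := torsionFree_completedPDPoly D d
  obtain ⟨F, hF, hFY⟩ := exists_completedPDPoly_lift D hP
    ((algebraMap D (CompletedPDPoly p D d)).comp D.delta.frob)
    (fun i => (p : CompletedPDPoly p D d) * z i)
    (fun i => hasDividedPowers_of_dvd (p := p) (dvd_mul_right _ _))
  refine ⟨F, hF, hFY, dvd_map_sub_pow_of_algebraMap fun x => ?_⟩
  let a := algebraMap (DividedPowerAlgebra D (Fin d → D)) (CompletedPDPoly p D d)
  have ha : ∀ {x}, (p : DividedPowerAlgebra D (Fin d → D)) ∣ x →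
      (p : CompletedPDPoly p D d) ∣ a x := fun {x} hx => by
    simpa using map_dvd a hx
  refine dvd_map_sub_pow_of_dividedPowerAlgebra (F := F.comp a) (a := a) (fun s => ?_)
    (fun n i => ?_) x
  · have h := map_dvd (algebraMap D (CompletedPDPoly p D d)) (D.delta.dvd_frob_sub_pow s)
    rw [map_natCast, map_sub, map_pow, ← RingHom.comp_apply] at h
    have h2 := hF s
    exact (congrArg (fun y => (p : CompletedPDPoly p D d) ∣ y - a (algebraMap D _ s) ^ p) h2).mpr h
  · rcases eq_or_ne n 0 with rfl | hn
    · simp [dp_zero]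
    · refine dvd_sub ?_ (by rw [← map_pow]; exact ha (dvd_dp_pow D.natTorsionFree hn i))
      obtain ⟨c, hc⟩ := factorial_mul_dvd_pow (p := p) (T := CompletedPDPoly p D d) hn
      have h1 : (n ! : CompletedPDPoly p D d) * (F.comp a) (dp D n (Pi.single i 1)) =
          n ! * (p * (c * z i ^ n)) := by
        rw [← map_natCast (F.comp a), ← map_mul, natFactorial_mul_dp_eq, map_pow, map_natCast]
        have h2 : (F.comp a) (dp D 1 (Pi.single i 1)) = p * z i := hFY i
        rw [h2, mul_pow, hc]
        ring
      exact ⟨_, hP.natTorsionFree.cancel (Nat.factorial_ne_zero n) h1⟩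

end PDFrobenius

/-! ### Maps out of the completed tensor product -/

section Tensor

variable {p : ℕ} {A : CrystallinePrism.{u} p} {R : Type u} [CommRing R]
  [Algebra A R] {T : Type*} [CommRing T]

open scoped TensorProduct

lemma exists_completedTensor_lift [IsAdicComplete (pIdeal p T) T] (f g : R →+* T)
    (h : ∀ a : A, f (algebraMap A R a) = g (algebraMap A R a)) :
    ∃ F : CompletedTensor A R →+* T, (∀ x, F (inl A R x) = f x) ∧ ∀ x, F (inr A R x) = g x := by
  let : Algebra A T := (f.comp (algebraMap A R)).toAlgebra
  let f' : R →ₐ[A] T := { f with commutes' := fun _ => rfl }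
  let g' : R →ₐ[A] T := { g with commutes' := fun a => (h a).symm }
  refine ⟨completionLift p (Algebra.TensorProduct.lift f' g' fun _ _ => .all _ _ : R ⊗[A] R →+* T),
    fun x => ?_, fun x => ?_⟩
  · rw [inl, RingHom.comp_apply, completionLift_algebraMap]
    simp [f']
  · rw [inr, RingHom.comp_apply, completionLift_algebraMap]
    simp [g']

lemma algebraMap_tmul (x y : R) :
    algebraMap (R ⊗[A] R) (CompletedTensor A R) (x ⊗ₜ y) = inl A R x * inr A R y := by
  rw [inl, inr, RingHom.comp_apply, RingHom.comp_apply, ← map_mul]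
  simp

lemma completedTensor_hom_ext [IsHausdorff (pIdeal p T) T] {F G : CompletedTensor A R →+* T}
    (hl : ∀ x, F (inl A R x) = G (inl A R x)) (hr : ∀ x, F (inr A R x) = G (inr A R x)) :
    F = G := by
  refine ringHom_ext_of_isHausdorff fun x => ?_
  induction x using TensorProduct.induction_on with
  | zero => simp
  | tmul x y => rw [algebraMap_tmul, map_mul, map_mul, hl, hr]
  | add x y hx hy => rw [map_add, map_add, map_add, hx, hy]

lemma map_tensorFrob [Fact p.Prime] {D₁ D₂ : DeltaStructureOver A R} {B : CrystallinePrism.{u} p}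
    {F : CompletedTensor A R →+* B}
    (hl : ∀ x, F (inl A R (D₁.frob x)) = B.delta.frob (F (inl A R x)))
    (hr : ∀ x, F (inr A R (D₂.frob x)) = B.delta.frob (F (inr A R x)))
    (x : CompletedTensor A R) : F (tensorFrob D₁ D₂ x) = B.delta.frob (F x) := by
  refine RingHom.congr_fun (f := F.comp (tensorFrob D₁ D₂)) (g := B.delta.frob.comp F)
    (completedTensor_hom_ext (fun x => ?_) fun x => ?_) x
  · rw [RingHom.comp_apply, tensorFrob_inl, hl, RingHom.comp_apply]
  · rw [RingHom.comp_apply, tensorFrob_inr, hr, RingHom.comp_apply]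

lemma inl_algebraMap (a : A) : inl A R (algebraMap A R a) = inr A R (algebraMap A R a) := by
  rw [inl, inr, RingHom.comp_apply, RingHom.comp_apply]
  congr 1
  simp [Algebra.TensorProduct.algebraMap_apply]

variable [IsAdicComplete (pIdeal p R) R]

lemma diagonal_inl (x : R) : diagonal A R (inl A R x) = x := by
  rw [diagonal, inl, RingHom.comp_apply, completionLift_algebraMap]
  simp

lemma diagonal_inr (x : R) : diagonal A R (inr A R x) = x := by
  rw [diagonal, inr, RingHom.comp_apply, completionLift_algebraMap]
  simp

lemma inl_sub_inr_mem_diagonalKer (x : R) : inl A R x - inr A R x ∈ diagonalKer A R := by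
  rw [diagonalKer, RingHom.mem_ker, map_sub, diagonal_inl, diagonal_inr, sub_self]

/-- Modulo `p`, the map `F` agrees with its restriction along `inl` composed with the diagonal, as
is seen on pure tensors; the latter kills `J`. No generators of `J` are needed. -/
lemma dvd_of_mem_diagonalKer {F : CompletedTensor A R →+* T}
    (hF : ∀ x, (p : T) ∣ F (inr A R x) - F (inl A R x)) {y : CompletedTensor A R}
    (hy : y ∈ diagonalKer A R) : (p : T) ∣ F y := by
  have h := dvd_map_sub_map_of_algebraMap (f := F) (g := (F.comp (inl A R)).comp (diagonal A R))
    (fun x => ?_) y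
  · rwa [RingHom.comp_apply, RingHom.mem_ker.mp hy, map_zero, sub_zero] at h
  · induction x using TensorProduct.induction_on with
    | zero => simp
    | tmul x y =>
      rw [algebraMap_tmul]
      simp only [map_mul, RingHom.comp_apply, diagonal_inl, diagonal_inr]
      rw [← mul_sub]
      exact (hF y).mul_left _
    | add x y hx hy =>
      rw [map_add, map_add, map_add, add_sub_add_comm]
      exact dvd_add hx hy

lemma map_sup_diagonalKer_le {𝔞 : Ideal R} {F : CompletedTensor A R →+* T}
    (h𝔞 : ∀ x ∈ 𝔞, (p : T) ∣ F (inl A R x))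
    (hF : ∀ x, (p : T) ∣ F (inr A R x) - F (inl A R x)) :
    𝔞.map (inl A R) ⊔ diagonalKer A R ≤ (pIdeal p T).comap F := by
  refine sup_le (Ideal.map_le_iff_le_comap.mpr fun x hx => ?_) fun y hy => ?_
  · exact mem_pIdeal.mpr (h𝔞 x hx)
  · exact mem_pIdeal.mpr (dvd_of_mem_diagonalKer hF hy)

end Tensor

/-! ### Lifting along a toric chart -/

section Chart

variable {p : ℕ} {A : CrystallinePrism.{u} p} {R : Type u} [CommRing R]
  [Algebra A R] {d : ℕ} {sq : CompletedTorus A d →ₐ[A] R}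

lemma chart_hom_ext (hsq : IsPCompletelyEtale p sq.toRingHom) {T : Type*} [CommRing T]
    [IsHausdorff (pIdeal p T) T] {f g : R →+* T}
    (hA : ∀ a : A, f (algebraMap A R a) = g (algebraMap A R a))
    (hX : ∀ i, f (sq (CompletedTorus.X A i)) = g (sq (CompletedTorus.X A i)))
    (h : ∀ x, (p : T) ∣ f x - g x) : f = g := by
  refine hsq.hom_ext (fun x => ?_) h
  refine RingHom.congr_fun (f := f.comp sq.toRingHom) (g := g.comp sq.toRingHom)
    (completedTorus_hom_ext (fun a => ?_) hX) x
  have := hA a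
  rw [← sq.commutes] at this
  exact this

/-- The elements `j(X_i) + p y_i` are still units, so they define a map from the torus that agrees
with `j` modulo `p`. Étaleness lifts it to `R`. -/
lemma exists_chart_lift (hsq : IsPCompletelyEtale p sq.toRingHom) {T : Type*} [CommRing T]
    [IsAdicComplete (pIdeal p T) T] (j : R →+* T) (y : Fin d → T) :
    ∃ τ : R →+* T, (∀ a : A, τ (algebraMap A R a) = j (algebraMap A R a)) ∧
      (∀ i, τ (sq (CompletedTorus.X A i)) = j (sq (CompletedTorus.X A i)) + p * y i) ∧
      ∀ x, (p : T) ∣ τ x - j x := by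
  obtain ⟨f, hfA, hfX⟩ := exists_completedTorus_lift (A := A) (j.comp (algebraMap A R))
    (fun i => j (sq (CompletedTorus.X A i)) + p * y i)
    (fun i => isUnit_add_of_dvd (((isUnit_completedTorus_X i).map sq).map j) (dvd_mul_right _ _))
  have hmod : (Ideal.Quotient.mk (pIdeal p T)).comp (j.comp sq.toRingHom) =
      (Ideal.Quotient.mk (pIdeal p T)).comp f := by
    have hp0 : (p : T ⧸ pIdeal p T) = 0 := by
      rw [← map_natCast (Ideal.Quotient.mk (pIdeal p T)), Ideal.Quotient.eq_zero_iff_mem]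
      exact Ideal.mem_span_singleton_self _
    -- In `T / p` the ideal `(p)` is zero, so `completedTorus_hom_ext` also proves the congruence
    -- modulo `p`.
    have : IsHausdorff (pIdeal p (T ⧸ pIdeal p T)) (T ⧸ pIdeal p T) := by
      rw [show pIdeal p (T ⧸ pIdeal p T) = ⊥ from Ideal.span_singleton_eq_bot.mpr hp0]
      infer_instance
    refine completedTorus_hom_ext (fun a => ?_) fun i => ?_
    · simp only [RingHom.comp_apply, hfA]
      exact congrArg _ (congrArg j (sq.commutes a))
    · simp only [RingHom.comp_apply, hfX, mk_eq_mk_iff]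
      exact ⟨-y i, by simp⟩
  obtain ⟨τ, hτ, hτj⟩ := hsq.exists_lift f ((Ideal.Quotient.mk (pIdeal p T)).comp j)
    fun x => RingHom.congr_fun hmod x
  refine ⟨τ, fun a => ?_, fun i => ?_, fun x => mk_eq_mk_iff.mp (hτj x)⟩
  · rw [← sq.commutes]
    exact (hτ _).trans ((hfA a).trans (congrArg j (sq.commutes a).symm))
  · exact (hτ _).trans (hfX i)

variable [hp : Fact p.Prime]

/-- If `τ ≡ j` modulo `p`, then `τ ∘ φ₂ ≡ j ∘ φ₁` modulo `p ^ 2`. -/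
lemma sq_dvd_map_frob_sub {δ₁ δ₂ : DeltaStructureOver A R}
    (hδ : ∀ x : R, δ₁.δ x - δ₂.δ x ∈ pIdeal p R) {T : Type*} [CommRing T] {τ j : R →+* T}
    (h : ∀ x, (p : T) ∣ τ x - j x) (x : R) :
    (p : T) ^ 2 ∣ τ (δ₂.frob x) - j (δ₁.frob x) := by
  -- Taking `p`-th powers improves the congruence to `τ(x) ^ p ≡ j(x) ^ p` modulo `p ^ 2`; the
  -- `δ`-terms carry a factor `p` already.
  obtain ⟨a, ha⟩ := dvd_sub_pow_of_dvd_sub (h x) 1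
  obtain ⟨b, hb⟩ := h (δ₂.δ x)
  obtain ⟨c, hc⟩ := mem_pIdeal.mp (hδ x)
  have hc' : j (δ₁.δ x) - j (δ₂.δ x) = p * j c := by
    rw [← map_sub, hc, map_mul, map_natCast]
  rw [pow_one] at ha
  refine ⟨a + b - j c, ?_⟩
  rw [DeltaStructure.frob_apply, DeltaStructure.frob_apply, map_add, map_add, map_mul, map_mul,
    map_pow, map_pow, map_natCast, map_natCast]
  linear_combination ha + p * hb - p * hc'

/-- Both `τ ∘ φ₂` and `φ ∘ τ` reduce to `τ(x) ^ p` modulo `p`, and they agree on `A` and on the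
coordinates; étaleness makes them equal. -/
lemma chart_lift_frob (hsq : IsPCompletelyEtale p sq.toRingHom) {δ₁ δ₂ : DeltaStructureOver A R}
    {C : CrystallinePrism.{u} p} {j τ : R →+* C} (hj : ∀ x, j (δ₁.frob x) = C.delta.frob (j x))
    (hA : ∀ a : A, τ (algebraMap A R a) = j (algebraMap A R a))
    (hX : ∀ i, τ (δ₂.frob (sq (CompletedTorus.X A i))) =
      C.delta.frob (τ (sq (CompletedTorus.X A i)))) (x : R) :
    τ (δ₂.frob x) = C.delta.frob (τ x) := by
  refine RingHom.congr_fun (f := τ.comp δ₂.frob) (g := C.delta.frob.comp τ)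
    (chart_hom_ext hsq (fun a => ?_) hX fun x => ?_) x
  · rw [RingHom.comp_apply, RingHom.comp_apply, frob_algebraMap, hA, hA, ← hj, frob_algebraMap]
  · have h1 := C.delta.dvd_frob_sub_pow (τ x)
    have h2 := map_dvd τ (δ₂.dvd_frob_sub_pow x)
    rw [map_natCast, map_sub, map_pow] at h2
    have h3 := dvd_sub h2 h1
    rwa [sub_sub_sub_cancel_right] at h3

end Chart

/-! ### The envelope as a completed divided power polynomial ring -/

section Comparison

set_option linter.unusedSectionVars false

variable {p : ℕ} [hp : Fact p.Prime] {A : CrystallinePrism.{u} p} {R : Type u} [CommRing R]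
  [Algebra A R] [IsAdicComplete (pIdeal p R) R] {d : ℕ} {sq : CompletedTorus A d →ₐ[A] R}
  {δ₁ δ₂ : DeltaStructureOver A R} {𝔞 : Ideal R} {K : Ideal (CompletedTensor A R)}

/-- Two maps from a prismatic envelope to a crystalline prism that agree on the ring are equal. -/
lemma PrismaticEnvelope.hom_ext {S : Type u} [CommRing S] {φ : S →+* S} {I : Ideal S}
    (E : PrismaticEnvelope p S φ I) {B : CrystallinePrism.{u} p} {g g' : E.prism →+* B}
    (hg : IsDeltaHom g) (hg' : IsDeltaHom g') (h : ∀ x, g (E.incl x) = g' (E.incl x)) : g = g' := by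
  refine (E.universal B (g.comp E.incl) (fun x => ?_) fun x hx => ?_).unique ⟨hg, rfl⟩
    ⟨hg', RingHom.ext fun x => (h x).symm⟩
  · rw [RingHom.comp_apply, E.incl_frob, hg.map_frob, RingHom.comp_apply]
  · exact pIdeal_le_comap p g (E.incl_mem x hx)

lemma dvd_incl_inr_sub_inl (E : PrismaticEnvelope p (CompletedTensor A R) (tensorFrob δ₁ δ₂) K)
    (hK : K = 𝔞.map (inl A R) ⊔ diagonalKer A R) (x : R) :
    (p : E.prism) ∣ E.incl (inr A R x) - E.incl (inl A R x) := by
  have h := mem_pIdeal.mp (E.incl_mem _ (hK ▸ Ideal.mem_sup_right (inl_sub_inr_mem_diagonalKer x)))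
  rwa [map_sub, dvd_sub_comm] at h

lemma incl_inl_frob (E : PrismaticEnvelope p (CompletedTensor A R) (tensorFrob δ₁ δ₂) K) (x : R) :
    E.incl (inl A R (δ₁.frob x)) = E.prism.delta.frob (E.incl (inl A R x)) := by
  rw [← tensorFrob_inl δ₁ δ₂, E.incl_frob]

lemma incl_inr_frob (E : PrismaticEnvelope p (CompletedTensor A R) (tensorFrob δ₁ δ₂) K) (x : R) :
    E.incl (inr A R (δ₂.frob x)) = E.prism.delta.frob (E.incl (inr A R x)) := by
  rw [← tensorFrob_inr δ₁ δ₂, E.incl_frob]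

/-- The elements `(1 ⊗ x - x ⊗ 1) / p` of the envelope have divided powers. -/
lemma exists_hasDividedPowers_incl_sub (hδ : ∀ x : R, δ₁.δ x - δ₂.δ x ∈ pIdeal p R)
    (E : PrismaticEnvelope p (CompletedTensor A R) (tensorFrob δ₁ δ₂) K)
    (hK : K = 𝔞.map (inl A R) ⊔ diagonalKer A R) (x : R) :
    ∃ y : E.prism, E.incl (inr A R x) = E.incl (inl A R x) + p * y ∧ HasDividedPowers y := by
  obtain ⟨y, hy⟩ := dvd_incl_inr_sub_inl E hK x
  refine ⟨y, by rw [← hy]; ring, hasDividedPowers_of_dvd_frob ?_⟩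
  -- Applying `φ` to `p y = 1 ⊗ x - x ⊗ 1` gives `p φ(y) = 1 ⊗ φ₂(x) - φ₁(x) ⊗ 1 = p ^ 2 c`, so
  -- `φ(y) = p c`.
  obtain ⟨c, hc⟩ := sq_dvd_map_frob_sub hδ (τ := E.incl.comp (inr A R))
    (j := E.incl.comp (inl A R)) (dvd_incl_inr_sub_inl E hK) x
  have hE : TorsionFree p E.prism := E.prism.torsionFree
  refine ⟨c, hE.cancel ?_⟩
  have h := congrArg E.prism.delta.frob hy
  rw [map_sub, map_mul, map_natCast, ← incl_inl_frob, ← incl_inr_frob] at h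
  rw [RingHom.comp_apply, RingHom.comp_apply, h] at hc
  rw [hc]
  ring

/-- The `δ`-structure on `D[Y₁, …, Y_d]_pd^∧` for which `R → D → D[Y₁, …, Y_d]_pd^∧` and the map
`R → D[Y₁, …, Y_d]_pd^∧` with `X_i ↦ X_i + p Y_i` commute with the Frobenius lifts `φ₁` and `φ₂`. -/
lemma exists_completedPDPoly_prism (hsq : IsPCompletelyEtale p sq.toRingHom)
    (hδ : ∀ x : R, δ₁.δ x - δ₂.δ x ∈ pIdeal p R) {D : CrystallinePrism.{u} p} {j : R →+* D}
    (hj : ∀ x, j (δ₁.frob x) = D.delta.frob (j x)) :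
    ∃ (F : CompletedPDPoly p D d →+* CompletedPDPoly p D d) (τ : R →+* CompletedPDPoly p D d),
      (∀ x, (p : CompletedPDPoly p D d) ∣ F x - x ^ p) ∧
      (∀ s, F (algebraMap D _ s) = algebraMap D _ (D.delta.frob s)) ∧
      (∀ a : A, τ (algebraMap A R a) = algebraMap D _ (j (algebraMap A R a))) ∧
      (∀ i, τ (sq (CompletedTorus.X A i)) =
        algebraMap D _ (j (sq (CompletedTorus.X A i))) + p * CompletedPDPoly.Y p D i) ∧
      (∀ x, (p : CompletedPDPoly p D d) ∣ τ x - algebraMap D _ (j x)) ∧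
      ∀ x, τ (δ₂.frob x) = F (τ x) := by
  let s := algebraMap D (CompletedPDPoly p D d)
  obtain ⟨τ, hτA, hτX, hτ⟩ := exists_chart_lift hsq (s.comp j) (CompletedPDPoly.Y p D)
  -- Compatibility with `τ` forces `F (p Y_i) = τ(φ₂ X_i) - j(φ₁ X_i) = p ^ 2 z_i`, that is, `F Y_i
  -- = p z_i`.
  choose z hz using fun i => sq_dvd_map_frob_sub hδ hτ (sq (CompletedTorus.X A i))
  obtain ⟨F, hFs, hFY, hF⟩ := exists_completedPDPoly_frob z
  refine ⟨F, τ, hF, hFs, hτA, hτX, hτ, ?_⟩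
  let P := CrystallinePrism.ofFrob (CompletedPDPoly p D d) (torsionFree_completedPDPoly D d) F hF
  have hP : P.delta.frob = F := DeltaStructure.frob_ofFrob (torsionFree_completedPDPoly D d) F hF
  have h := chart_lift_frob (δ₁ := δ₁) (δ₂ := δ₂) hsq (C := P) (j := s.comp j) (τ := τ)
    (fun x => ?_) hτA (fun i => ?_)
  · exact fun x => (h x).trans (RingHom.congr_fun hP _)
  · refine Eq.trans ?_ (RingHom.congr_fun hP _).symm
    exact (congrArg s (hj x)).trans (hFs _).symm
  · refine Eq.trans ?_ (RingHom.congr_fun hP _).symm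
    rw [hτX, map_add, map_mul, map_natCast, hFY]
    have h1 := hz i
    have h2 : F ((s.comp j) (sq (CompletedTorus.X A i))) =
        (s.comp j) (δ₁.frob (sq (CompletedTorus.X A i))) :=
      (hFs _).trans (congrArg s (hj _)).symm
    rw [h2]
    linear_combination h1

set_option maxHeartbeats 1000000 in
-- The isomorphism and its inverse come from the universal properties of the two sides. The ideal
-- enters as a variable `K` with an equation so that `(p) ⊔ J` is covered as well.
lemma exists_envelope_equiv (hsq : IsPCompletelyEtale p sq.toRingHom)
    (hδ : ∀ x : R, δ₁.δ x - δ₂.δ x ∈ pIdeal p R) (D : PrismaticEnvelope p R δ₁.frob 𝔞)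
    (E : PrismaticEnvelope p (CompletedTensor A R) (tensorFrob δ₁ δ₂) K)
    (hK : K = 𝔞.map (inl A R) ⊔ diagonalKer A R) {i : D.prism →+* E.prism} (hi : IsDeltaHom i)
    (hiD : ∀ x, i (D.incl x) = E.incl (inl A R x)) :
    ∃ ι : E.prism ≃+* CompletedPDPoly p D.prism d,
      (∀ y, ι (i y) = algebraMap D.prism _ y) ∧
      (∀ k, ι (E.incl (inr A R (sq (CompletedTorus.X A k)))) =
        algebraMap D.prism _ (D.incl (sq (CompletedTorus.X A k))) +
          p * CompletedPDPoly.Y p D.prism k) := by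
  obtain ⟨F, τ, hF, hFs, hτA, hτX, hτ, hτF⟩ := exists_completedPDPoly_prism hsq hδ D.incl_frob
  have htf := torsionFree_completedPDPoly D.prism d
  have hE : TorsionFree p E.prism := E.prism.torsionFree
  let s := algebraMap D.prism (CompletedPDPoly p D.prism d)
  let P := CrystallinePrism.ofFrob (CompletedPDPoly p D.prism d) htf F hF
  have hP : P.delta.frob = F := DeltaStructure.frob_ofFrob htf F hF
  -- the map from the envelope
  obtain ⟨f, hfl, hfr⟩ := exists_completedTensor_lift (s.comp D.incl) τ fun a => (hτA a).symm
  have hfF : ∀ x, f (tensorFrob δ₁ δ₂ x) = P.delta.frob (f x) :=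
    map_tensorFrob (B := P) (F := f) (fun x => by
      rw [hP]
      rw [hfl, hfl, RingHom.comp_apply, RingHom.comp_apply, D.incl_frob]
      exact (hFs _).symm) (fun x => by
      rw [hP]
      rw [hfr, hfr, hτF])
  have hfK : ∀ x ∈ K, f x ∈ pIdeal p P := by
    intro x hx
    rw [hK] at hx
    refine map_sup_diagonalKer_le (fun x hx => ?_) (fun x => ?_) hx
    · rw [hfl]
      simpa [s] using map_dvd s (mem_pIdeal.mp (D.incl_mem x hx))
    · rw [hfl, hfr]
      exact hτ x
  obtain ⟨g, ⟨hg, hgf⟩, -⟩ := E.universal P f hfF hfK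
  have hg' : ∀ x, g (E.incl x) = f x := fun x => RingHom.congr_fun hgf x
  -- the map to the envelope
  choose y hy hyd using fun k => exists_hasDividedPowers_incl_sub hδ E hK
    (sq (CompletedTorus.X A k))
  obtain ⟨h, hhs, hhY⟩ := exists_completedPDPoly_lift D.prism hE i y hyd
  -- Both maps are congruent to `x ↦ x ⊗ 1` modulo `p` and agree on `A` and the coordinates, so
  -- étaleness applies.
  have hhτ : h.comp τ = E.incl.comp (inr A R) := by
    refine chart_hom_ext hsq (fun a => ?_) (fun k => ?_) fun x => ?_
    · rw [RingHom.comp_apply, RingHom.comp_apply, hτA, hhs, hiD, inl_algebraMap]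
    · rw [RingHom.comp_apply, RingHom.comp_apply, hτX, map_add, map_mul, map_natCast, hhs, hhY,
        hiD, hy]
    · have h1 := map_dvd h (hτ x)
      rw [map_natCast, map_sub, hhs, hiD] at h1
      have h2 := dvd_sub h1 (dvd_incl_inr_sub_inl E hK x)
      rwa [sub_sub_sub_cancel_right] at h2
  have hhF : ∀ x, h (F x) = E.prism.delta.frob (h x) := by
    refine RingHom.congr_fun (f := h.comp F) (g := E.prism.delta.frob.comp h)
      (completedPDPoly_hom_ext hE (fun x => ?_) fun k => hE.cancel ?_)
    · rw [RingHom.comp_apply, RingHom.comp_apply, hFs, hhs, hhs, hi.map_frob]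
    -- On `p Y_k = τ(X_k) - X_k` both Frobenius maps are known; `p` is cancelled in the envelope.
    · have h1 : (p : CompletedPDPoly p D.prism d) * CompletedPDPoly.Y p D.prism k =
          τ (sq (CompletedTorus.X A k)) - s (D.incl (sq (CompletedTorus.X A k))) := by
        rw [hτX, add_sub_cancel_left]
      have h2 := congrArg (fun z => h (F z)) h1
      have h3 := congrArg (fun z => E.prism.delta.frob (h z)) h1
      have h4 : ∀ x, h (τ x) = E.incl (inr A R x) := RingHom.congr_fun hhτ
      simp only [map_mul, map_natCast, map_sub] at h2 h3
      rw [RingHom.comp_apply, RingHom.comp_apply, h2, h3, ← hτF, hFs, hhs, hhs, h4, h4,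
        hi.map_frob, incl_inr_frob]
  have hhδ : IsDeltaHom (B := P) h := IsDeltaHom.of_map_frob fun x => by rw [hP]; exact hhF x
  have hhf : h.comp f = E.incl := by
    refine completedTensor_hom_ext (fun x => ?_) fun x => ?_
    · rw [RingHom.comp_apply, hfl, RingHom.comp_apply, hhs, hiD]
    · rw [RingHom.comp_apply, hfr]
      exact RingHom.congr_fun hhτ x
  have hhg : h.comp g = RingHom.id E.prism :=
    E.hom_ext (fun x => (congrArg h (hg x)).trans (hhδ _)) (fun _ => rfl) fun x => by
      rw [RingHom.comp_apply, hg']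
      exact RingHom.congr_fun hhf x
  have hs : IsDeltaHom (C := P) s := IsDeltaHom.of_map_frob fun x => by rw [hP]; exact (hFs x).symm
  have hgi : g.comp i = s := D.hom_ext (B := P)
    (fun x => (congrArg g (hi x)).trans (hg _)) hs fun x => by
      rw [RingHom.comp_apply, hiD, hg', hfl]
      rfl
  have hgX : ∀ k, g (E.incl (inr A R (sq (CompletedTorus.X A k)))) =
      s (D.incl (sq (CompletedTorus.X A k))) + p * CompletedPDPoly.Y p D.prism k := fun k => by
    rw [hg', hfr, hτX]
  have hgh : (RingHom.comp g h : CompletedPDPoly p D.prism d →+* CompletedPDPoly p D.prism d) =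
      RingHom.id (CompletedPDPoly p D.prism d) := by
    refine completedPDPoly_hom_ext htf (fun x => ?_) fun k => htf.cancel ?_
    · rw [RingHom.comp_apply, hhs]
      exact RingHom.congr_fun hgi x
    · have h1 := hgX k
      rw [hy, map_add, map_mul, map_natCast, hg', hfl, RingHom.comp_apply] at h1
      rw [RingHom.comp_apply, hhY]
      exact add_left_cancel h1
  exact ⟨RingEquiv.ofRingHom g h hgh hhg, RingHom.congr_fun hgi, hgX⟩

end Comparison

lemma injective_algebraMap_completedPDPoly {p : ℕ} [Fact p.Prime] (D : CrystallinePrism.{u} p)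
    (d : ℕ) : Function.Injective (algebraMap D (CompletedPDPoly p D d)) := by
  obtain ⟨ρ, hρ, -⟩ := exists_completedPDPoly_lift D (d := d) D.torsionFree (RingHom.id D) 0
    fun _ => hasDividedPowers_zero
  exact Function.LeftInverse.injective (g := ρ) hρ

/-! ### Injectivity of the second embedding, and the coproduct -/

section Coproduct

variable {p : ℕ} [hp : Fact p.Prime] {A : CrystallinePrism.{u} p} {R : Type u} [CommRing R]
  [Algebra A R] [IsAdicComplete (pIdeal p R) R] {d : ℕ} {sq : CompletedTorus A d →ₐ[A] R}
  {δ₁ δ₂ : DeltaStructureOver A R} {𝔞 : Ideal R} {K : Ideal (CompletedTensor A R)}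

/-- The retraction `Y_k ↦ 0` turns `x ↦ 1 ⊗ x` into a map that agrees with `D.incl` on `A` and the
coordinates and modulo `p`. By étaleness it is `D.incl`, which is injective. -/
lemma injective_incl_inr (hsq : IsPCompletelyEtale p sq.toRingHom)
    (D : PrismaticEnvelope p R δ₁.frob 𝔞) (hD : Function.Injective D.incl)
    (E : PrismaticEnvelope p (CompletedTensor A R) (tensorFrob δ₁ δ₂) K)
    (hK : K = 𝔞.map (inl A R) ⊔ diagonalKer A R)
    (ι : E.prism →+* CompletedPDPoly p D.prism d)
    (hι : ∀ y, ι (E.incl (inl A R y)) = algebraMap D.prism _ (D.incl y))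
    (hX : ∀ k, ι (E.incl (inr A R (sq (CompletedTorus.X A k)))) =
        algebraMap D.prism _ (D.incl (sq (CompletedTorus.X A k))) +
          p * CompletedPDPoly.Y p D.prism k) :
    Function.Injective (fun r : R => E.incl (inr A R r)) := by
  obtain ⟨ρ, hρ, hρY⟩ := exists_completedPDPoly_lift D.prism (d := d) D.prism.torsionFree
    (RingHom.id _) 0 fun _ => hasDividedPowers_zero
  have h : ((ρ.comp ι).comp E.incl).comp (inr A R) = D.incl := by
    refine chart_hom_ext hsq (fun a => ?_) (fun k => ?_) fun x => ?_
    · simp only [RingHom.comp_apply]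
      rw [← inl_algebraMap, hι, hρ, RingHom.id_apply]
    · simp only [RingHom.comp_apply]
      rw [hX, map_add, hρ, map_mul, hρY, Pi.zero_apply, mul_zero, add_zero, RingHom.id_apply]
    · have h1 := map_dvd (ρ.comp ι) (dvd_incl_inr_sub_inl E hK x)
      rw [map_natCast, map_sub, RingHom.comp_apply ρ ι (E.incl (inl A R x)), hι, hρ] at h1
      exact h1
  refine Function.Injective.of_comp (f := ρ.comp ι) ?_
  have h2 : (ρ.comp ι) ∘ (fun r : R => E.incl (inr A R r)) = D.incl := congrArg DFunLike.coe h
  rw [h2]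
  exact hD

/-- A `p`-torsion free, `p`-adically complete `δ`-ring is the prismatic envelope of its
ideal `(p)`. -/
@[reducible]
def PrismaticEnvelope.self (hR : TorsionFree p R) (D : DeltaStructure p R) :
    PrismaticEnvelope p R D.frob (pIdeal p R) where
  prism := { carrier := R, delta := D, complete := inferInstance, torsionFree := hR }
  incl := RingHom.id R
  incl_frob _ := rfl
  incl_mem _ hx := hx
  universal _ f hf _ := ⟨f, ⟨IsDeltaHom.of_map_frob hf, rfl⟩, fun _ hg => hg.2⟩

/-- The map from the prismatic envelope of `R` to the one of `R ⊗̂_A R` induced by `x ↦ x ⊗ 1`. -/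
lemma exists_envelope_map_inl (D : PrismaticEnvelope p R δ₁.frob 𝔞)
    (E : PrismaticEnvelope p (CompletedTensor A R) (tensorFrob δ₁ δ₂) K)
    (hK : K = 𝔞.map (inl A R) ⊔ diagonalKer A R) :
    ∃ i : D.prism →+* E.prism, IsDeltaHom i ∧ ∀ x, i (D.incl x) = E.incl (inl A R x) := by
  obtain ⟨i, ⟨hi, hi'⟩, -⟩ := D.universal E.prism (E.incl.comp (inl A R)) (incl_inl_frob E)
    fun x hx => E.incl_mem _ (hK ▸ Ideal.mem_sup_left (Ideal.mem_map_of_mem _ hx))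
  exact ⟨i, hi, RingHom.congr_fun hi'⟩

/-- The map from the prismatic envelope of `R` to the one of `R ⊗̂_A R` induced by `x ↦ 1 ⊗ x`. -/
lemma exists_envelope_map_inr (D : PrismaticEnvelope p R δ₂.frob 𝔞)
    (E : PrismaticEnvelope p (CompletedTensor A R) (tensorFrob δ₁ δ₂) K)
    (hK : K = 𝔞.map (inl A R) ⊔ diagonalKer A R) :
    ∃ i : D.prism →+* E.prism, IsDeltaHom i ∧ ∀ x, i (D.incl x) = E.incl (inr A R x) := by
  obtain ⟨i, ⟨hi, hi'⟩, -⟩ := D.universal E.prism (E.incl.comp (inr A R)) (incl_inr_frob E)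
    fun x hx => by
      have h1 := mem_pIdeal.mp (E.incl_mem (inl A R x)
        (hK ▸ Ideal.mem_sup_left (Ideal.mem_map_of_mem _ hx)))
      exact mem_pIdeal.mpr
        ((dvd_iff_dvd_of_dvd_sub (dvd_incl_inr_sub_inl E hK x)).mpr h1)
  exact ⟨i, hi, RingHom.congr_fun hi'⟩

variable {D₁ : PrismaticEnvelope p R δ₁.frob 𝔞} {D₂ : PrismaticEnvelope p R δ₂.frob 𝔞}
  {E : PrismaticEnvelope p (CompletedTensor A R) (tensorFrob δ₁ δ₂)
    (𝔞.map (inl A R) ⊔ diagonalKer A R)}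

/-- The maps `j₁` and `j₂` agree on `A` and so combine to a map on `R ⊗̂_A R`. They induce the same
point `R / 𝔞 → C / p`, and this is what sends `J` into `(p)`. -/
lemma PrismaticEnvelope.exists_toRelPrismTensor_desc {C : RelPrism A (R ⧸ 𝔞)}
    (j₁ : RelPrism.Hom D₁.toRelPrism C) (j₂ : RelPrism.Hom D₂.toRelPrism C) :
    ∃ m : RelPrism.Hom E.toRelPrismTensor C,
      (∀ x, m.map (E.incl (inl A R x)) = j₁.map (D₁.incl x)) ∧
      ∀ x, m.map (E.incl (inr A R x)) = j₂.map (D₂.incl x) := by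
  have hpt₁ : ∀ x : R, Ideal.Quotient.mk _ (j₁.map (D₁.incl x)) =
      C.point (Ideal.Quotient.mk 𝔞 x) := fun x => j₁.map_point (Ideal.Quotient.mk 𝔞 x)
  have hpt₂ : ∀ x : R, Ideal.Quotient.mk _ (j₂.map (D₂.incl x)) =
      C.point (Ideal.Quotient.mk 𝔞 x) := fun x => j₂.map_point (Ideal.Quotient.mk 𝔞 x)
  obtain ⟨F, hFl, hFr⟩ := exists_completedTensor_lift (j₁.map.comp D₁.incl)
    (j₂.map.comp D₂.incl) fun a => (j₁.map_str a).trans (j₂.map_str a).symm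
  obtain ⟨m, ⟨hm, hmF⟩, -⟩ := E.universal C.prism F
    (map_tensorFrob (fun x => by
      rw [hFl, hFl, RingHom.comp_apply, RingHom.comp_apply, D₁.incl_frob]
      exact IsDeltaHom.map_frob j₁.isDeltaHom _) (fun x => by
      rw [hFr, hFr, RingHom.comp_apply, RingHom.comp_apply, D₂.incl_frob]
      exact IsDeltaHom.map_frob j₂.isDeltaHom _))
    (fun x hx => map_sup_diagonalKer_le (fun x hx => by
      rw [hFl, RingHom.comp_apply]
      simpa using map_dvd j₁.map (mem_pIdeal.mp (D₁.incl_mem x hx))) (fun x => by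
      rw [hFl, hFr, RingHom.comp_apply, RingHom.comp_apply, ← mk_eq_mk_iff, hpt₁, hpt₂]) hx)
  have hm' : ∀ x, m (E.incl x) = F x := RingHom.congr_fun hmF
  have hml : ∀ x, m (E.incl (inl A R x)) = j₁.map (D₁.incl x) := fun x => (hm' _).trans (hFl x)
  refine ⟨⟨m, hm, fun a => (hml _).trans (j₁.map_str a), fun b => ?_⟩, hml,
    fun x => (hm' _).trans (hFr x)⟩
  obtain ⟨x, rfl⟩ := Ideal.Quotient.mk_surjective b
  rw [← hpt₁, ← hml]
  rfl

lemma PrismaticEnvelope.toRelPrismTensor_hom_ext {C : RelPrism A (R ⧸ 𝔞)}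
    {m m' : RelPrism.Hom E.toRelPrismTensor C}
    (hl : ∀ x, m.map (E.incl (inl A R x)) = m'.map (E.incl (inl A R x)))
    (hr : ∀ x, m.map (E.incl (inr A R x)) = m'.map (E.incl (inr A R x))) : m = m' :=
  RelPrism.Hom.ext <| E.hom_ext m.isDeltaHom m'.isDeltaHom <|
    RingHom.congr_fun (f := m.map.comp E.incl) (g := m'.map.comp E.incl)
      (completedTensor_hom_ext hl hr)

/-- The prismatic envelope of `R ⊗̂_A R` is the coproduct of those of `R`. -/
lemma PrismaticEnvelope.nonempty_isColimit {i₁ : D₁.toRelPrism ⟶ E.toRelPrismTensor}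
    {i₂ : D₂.toRelPrism ⟶ E.toRelPrismTensor}
    (h₁ : ∀ r : R, i₁.map (D₁.incl r) = E.incl (inl A R r))
    (h₂ : ∀ r : R, i₂.map (D₂.incl r) = E.incl (inr A R r)) :
    Nonempty (Limits.IsColimit (Limits.BinaryCofan.mk i₁ i₂)) := by
  choose m hml hmr using fun (C : RelPrism A (R ⧸ 𝔞)) (j₁ : RelPrism.Hom D₁.toRelPrism C)
    (j₂ : RelPrism.Hom D₂.toRelPrism C) => exists_toRelPrismTensor_desc (E := E) j₁ j₂
  refine ⟨Limits.BinaryCofan.IsColimit.mk _ (fun {C} j₁ j₂ => m C j₁ j₂) (fun {C} j₁ j₂ => ?_)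
    (fun {C} j₁ j₂ => ?_) fun {C} j₁ j₂ n hn₁ hn₂ => ?_⟩
  · refine RelPrism.Hom.ext (D₁.hom_ext (i₁ ≫ m C j₁ j₂).isDeltaHom j₁.isDeltaHom fun x => ?_)
    exact (congrArg (m C j₁ j₂).map (h₁ x)).trans (hml C j₁ j₂ x)
  · refine RelPrism.Hom.ext (D₂.hom_ext (i₂ ≫ m C j₁ j₂).isDeltaHom j₂.isDeltaHom fun x => ?_)
    exact (congrArg (m C j₁ j₂).map (h₂ x)).trans (hmr C j₁ j₂ x)
  · refine toRelPrismTensor_hom_ext (fun x => ?_) fun x => ?_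
    · rw [hml, ← hn₁, ← h₁]
      rfl
    · rw [hmr, ← hn₂, ← h₂]
      rfl

end Coproduct

end Prismatic

end

open Prismatic in
theorem mainTheorem5 {p : ℕ} [Fact p.Prime] (A : CrystallinePrism.{u} p)
    {R : Type u} [CommRing R] [Algebra A R] [IsAdicComplete (pIdeal p R) R]
    {d : ℕ} (sq : CompletedTorus A d →ₐ[A] R) (hsq : IsPCompletelyEtale p sq.toRingHom)
    (δ₁ δ₂ : DeltaStructureOver A R) (hδ : ∀ x : R, δ₁.δ x - δ₂.δ x ∈ pIdeal p R)
    (𝔞 : Ideal R) (h𝔞 : (p : R) ∈ 𝔞) :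
    (Nonempty (PrismaticEnvelope p (CompletedTensor A R) (tensorFrob δ₁ δ₂)
        (pIdeal p (CompletedTensor A R) ⊔ diagonalKer A R)) ∧
      ∀ R₁₂ : PrismaticEnvelope p (CompletedTensor A R) (tensorFrob δ₁ δ₂)
          (pIdeal p (CompletedTensor A R) ⊔ diagonalKer A R),
        Function.Injective (algebraMap R (CompletedPDPoly p R d)) ∧
        Function.Injective (fun r : R => R₁₂.incl (inr A R r)) ∧
        ∃ ι : R₁₂.prism ≃+* CompletedPDPoly p R d,
          (∀ r : R, ι (R₁₂.incl (inl A R r)) = algebraMap R (CompletedPDPoly p R d) r) ∧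
          ∀ i : Fin d, ι (R₁₂.incl (inr A R (sq (CompletedTorus.X A i)))) =
            algebraMap R (CompletedPDPoly p R d) (sq (CompletedTorus.X A i)) +
              (p : CompletedPDPoly p R d) * CompletedPDPoly.Y p R i) ∧
    (Nonempty (PrismaticEnvelope p R δ₁.frob 𝔞) ∧ Nonempty (PrismaticEnvelope p R δ₂.frob 𝔞) ∧
      Nonempty (PrismaticEnvelope p (CompletedTensor A R) (tensorFrob δ₁ δ₂)
        (𝔞.map (inl A R) ⊔ diagonalKer A R)) ∧
      ∀ (D₁ : PrismaticEnvelope p R δ₁.frob 𝔞) (D₂ : PrismaticEnvelope p R δ₂.frob 𝔞)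
        (D₁₂ : PrismaticEnvelope p (CompletedTensor A R) (tensorFrob δ₁ δ₂)
          (𝔞.map (inl A R) ⊔ diagonalKer A R)),
        ∃ (i₁ : D₁.toRelPrism ⟶ D₁₂.toRelPrismTensor) (i₂ : D₂.toRelPrism ⟶ D₁₂.toRelPrismTensor),
          (∀ r : R, i₁.map (D₁.incl r) = D₁₂.incl (inl A R r)) ∧
          (∀ r : R, i₂.map (D₂.incl r) = D₁₂.incl (inr A R r)) ∧
          Nonempty (CategoryTheory.Limits.IsColimit
            (CategoryTheory.Limits.BinaryCofan.mk i₁ i₂)) ∧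
          ∃ ι : D₁₂.prism ≃+* CompletedPDPoly p D₁.prism d,
            (∀ y : D₁.prism, ι (i₁.map y) = algebraMap D₁.prism (CompletedPDPoly p D₁.prism d) y) ∧
            ∀ i : Fin d, ι (D₁₂.incl (inr A R (sq (CompletedTorus.X A i)))) =
              algebraMap D₁.prism (CompletedPDPoly p D₁.prism d)
                  (D₁.incl (sq (CompletedTorus.X A i))) +
                (p : CompletedPDPoly p D₁.prism d) * CompletedPDPoly.Y p D₁.prism i) := by
  have hR : TorsionFree p R := hsq.torsionFree torsionFree_completedTorus
  refine ⟨⟨⟨prismaticEnvelope _ _⟩, fun R₁₂ => ?_⟩, ⟨prismaticEnvelope _ _⟩,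
    ⟨prismaticEnvelope _ _⟩, ⟨prismaticEnvelope _ _⟩, fun D₁ D₂ D₁₂ => ?_⟩
  -- Part (1) is the comparison for `𝔞 = (p)`, with `R` as its own envelope.
  · have hK : pIdeal p (CompletedTensor A R) ⊔ diagonalKer A R =
        (pIdeal p R).map (inl A R) ⊔ diagonalKer A R := by
      simp only [pIdeal, Ideal.map_span, Set.image_singleton, map_natCast]
    let D := PrismaticEnvelope.self hR δ₁.toDeltaStructure
    obtain ⟨i, hi, hiD⟩ := exists_envelope_map_inl D R₁₂ hK
    obtain ⟨ι, hι, hX⟩ := exists_envelope_equiv hsq hδ D R₁₂ hK hi hiD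
    have hι' : ∀ r : R, ι (R₁₂.incl (inl A R r)) = algebraMap R (CompletedPDPoly p R d) r :=
      fun r => (congrArg ι (hiD r)).symm.trans (hι r)
    exact ⟨injective_algebraMap_completedPDPoly D.prism d,
      injective_incl_inr hsq D Function.injective_id R₁₂ hK ι hι' hX, ι, hι', hX⟩
  · obtain ⟨i₁, hi₁, h₁⟩ := exists_envelope_map_inl D₁ D₁₂ rfl
    obtain ⟨i₂, hi₂, h₂⟩ := exists_envelope_map_inr D₂ D₁₂ rfl
    obtain ⟨ι, hι, hX⟩ := exists_envelope_equiv hsq hδ D₁ D₁₂ rfl hi₁ h₁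
    let I₁ : D₁.toRelPrism ⟶ D₁₂.toRelPrismTensor :=
      RelPrism.Hom.mk i₁ hi₁ (fun a => h₁ _) fun b => by
        obtain ⟨x, rfl⟩ := Ideal.Quotient.mk_surjective b
        exact congrArg (Ideal.Quotient.mk _) (h₁ x)
    let I₂ : D₂.toRelPrism ⟶ D₁₂.toRelPrismTensor :=
      RelPrism.Hom.mk i₂ hi₂ (fun a => (h₂ _).trans (congrArg _ (inl_algebraMap a).symm))
        fun b => by
          obtain ⟨x, rfl⟩ := Ideal.Quotient.mk_surjective b
          -- The point of `D₁₂` is defined through `x ⊗ 1`, which agrees with `1 ⊗ x` modulo `p`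
          -- because `J` goes into `(p)`.
          refine (congrArg (Ideal.Quotient.mk _) (h₂ x)).trans (mk_eq_mk_iff.mpr ?_)
          exact dvd_incl_inr_sub_inl D₁₂ rfl x
    exact ⟨I₁, I₂, h₁, h₂, PrismaticEnvelope.nonempty_isColimit h₁ h₂, ι, hι, hX⟩
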